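/- Let $d\ge 2$, let $\mathbf X=(X_1,\dots,X_d)$ be a random vector with values in $\mathbb R^d$ on a probability space $(\Omega,\mathcal F,\mathbb P)$, and let $F_i(t)=\mathbb P(X_i\le t)$ and $F_i(t-)=\mathbb P(X_i<t)$ for $i\in[d]=\{1,\dots,d\}$. A copula is a probability distribution $C$ on $\mathbb R^d$ whose $d$ marginals are uniform on $[0,1]$, identified with its distribution function; it is a copula of $\mathbf X$ if $\mathbb P(\mathbf X\le \mathbf x)=C(F_1(x_1),\dots,F_d(x_d))$ for all $\mathbf x\in\mathbb R^d$. The checkerboard copula $C_{\mathbf X}^{\perp}$ is the distribution of $(U_1,\dots,U_d)$, where $U_i=F_i(X_i-)+V_i\,(F_i(X_i)-F_i(X_i-))$ and $(V_1,\dots,V_d)$ is uniform on $[0,1]^d$ and independent of $\mathbf X$ (on an extension of the probability space if necessary). For $A\subseteq[d]$ write $\mathbf X_A=(X_k)_{k\in A}$ and $\mathbf X_{-i}=(X_k)_{k\neq i}$; inequalities between vectors are componentwise, "increasing" and "decreasing" are meant in the weak sense, and all functions and sets below are Borel measurable. A set $S$ is decreasing if $\mathbf x\in S$ and $\mathbf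 y\le\mathbf x$ imply $\mathbf y\in S$. The random vector $\mathbf X$ is - PA (positively associated) if $\mathrm{Cov}(f(\mathbf X_A),g(\mathbf X_B))\ge 0$ for all $A,B\subseteq[d]$ and all real functions $f,g$ that are both coordinatewise increasing or both coordinatewise decreasing and for which the covariance exists, that is, $f(\mathbf X_A)$, $g(\mathbf X_B)$ and their product are integrable; NA (negatively associated) if, for the same $f,g$ but with $A,B$ disjoint, $\mathrm{Cov}(f(\mathbf X_A),g(\mathbf X_B))\le 0$; - PRD (positively regression dependent), respectively NRD (negatively regression dependent), if for every $i\in[d]$ and every coordinatewise increasing real function $g$ with $g(\mathbf X_{-i})$ integrable, $\mathbb E[g(\mathbf X_{-i})\mid X_i]$ is almost surely an increasing, respectively decreasing, function of $X_i$, that is, it equals $h(X_i)$ almost surely for some $h$ that is increasing, respectively decreasing, on a set $T\subseteq\mathbb R$ with $X_i\in T$ almost surely; - WPA (weakly positively associated), respectively WNA (weakly negatively associated), if $\mathbb P(\mathbf X_{-i}\in S\mid X_i\le x)\ge \mathbb P(\mathbf X_{-i}\in S)$, respectively $\le$, for every $i\in[d]$, every decreasing set $S\subseteq\mathbb R^{d-1}$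 and every $x\in\mathbb R$ with $\mathbb P(X_i\le x)>0$; - POD (positively orthant dependent), respectively NOD (negatively orthant dependent), if for every $\mathbf x\in\mathbb R^d$ both $\mathbb P(\mathbf X\le\mathbf x)\ge\prod_{i=1}^d\mathbb P(X_i\le x_i)$ and $\mathbb P(X_i>x_i\text{ for all }i)\ge\prod_{i=1}^d\mathbb P(X_i>x_i)$ hold, respectively both with $\le$. A distribution on $\mathbb R^d$ has one of these properties if a random vector with that distribution has it. Let $\mathfrak D$ be any of PA, PRD, WPA, POD, NA, NRD, WNA or NOD. Then $\mathbf X$ satisfies $\mathfrak D$ if and only if there is a copula of $\mathbf X$ that satisfies $\mathfrak D$. Moreover, this copula can be chosen as the checkerboard copula: $C_{\mathbf X}^{\perp}$ is a copula of $\mathbf X$, and it satisfies $\mathfrak D$ whenever $\mathbf X$ does. -/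

import Mathlib

open MeasureTheory ProbabilityTheory Set

noncomputable section

namespace CopulaDependence

variable {Ω : Type*} [MeasurableSpace Ω] {d : ℕ}

/-! ### Dependence concepts for a random vector `X = (X_1, …, X_d)` on `(Ω, P)` -/

/-- The subvector `X_A = (X_k)_{k ∈ A}`. -/
def sub (X : Ω → Fin d → ℝ) (A : Finset (Fin d)) (ω : Ω) : A → ℝ :=
  fun k => X ω k

/-- The subvector `X_{-i}`, all coordinates except the `i`-th. -/
def omitCoord (X : Ω → Fin d → ℝ) (i : Fin d) (ω : Ω) : {j : Fin d // j ≠ i} → ℝ :=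
  fun j => X ω j

/-- `f` and `g` are both coordinatewise increasing, or both coordinatewise decreasing. -/
def BothMonotone {α β : Type*} [Preorder α] [Preorder β] (f : α → ℝ) (g : β → ℝ) : Prop :=
  (Monotone f ∧ Monotone g) ∨ (Antitone f ∧ Antitone g)

/-- The covariance of the random variables `Y` and `Z` exists (as a real number). -/
def CovExists (P : Measure Ω) (Y Z : Ω → ℝ) : Prop :=
  Integrable Y P ∧ Integrable Z P ∧ Integrable (fun ω => Y ω * Z ω) P

/-- Positively associated. -/
def IsPA (P : Measure Ω) (X : Ω → Fin d → ℝ) : Prop :=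
  ∀ (A B : Finset (Fin d)) (f : (A → ℝ) → ℝ) (g : (B → ℝ) → ℝ),
    Measurable f → Measurable g → BothMonotone f g →
    CovExists P (fun ω => f (sub X A ω)) (fun ω => g (sub X B ω)) →
    0 ≤ covariance (fun ω => f (sub X A ω)) (fun ω => g (sub X B ω)) P

/-- Negatively associated. -/
def IsNA (P : Measure Ω) (X : Ω → Fin d → ℝ) : Prop :=
  ∀ (A B : Finset (Fin d)), Disjoint A B → ∀ (f : (A → ℝ) → ℝ) (g : (B → ℝ) → ℝ),
    Measurable f → Measurable g → BothMonotone f g →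
    CovExists P (fun ω => f (sub X A ω)) (fun ω => g (sub X B ω)) →
    covariance (fun ω => f (sub X A ω)) (fun ω => g (sub X B ω)) P ≤ 0

/-- `E[Y | Z]` is an increasing function of `Z`: almost surely `E[Y | Z] = h(Z)` for a function `h`
that is increasing on a set of values that `Z` takes almost surely.  (A real-valued `h` that is
increasing on all of `ℝ` need not exist, for instance for `Z` uniform on `(0,1)` and
`Y = 1 / (1 - Z) ^ (1/2)`.) -/
def CondExpIncreasing (P : Measure Ω) (Y Z : Ω → ℝ) : Prop :=
  ∃ (h : ℝ → ℝ) (T : Set ℝ), MonotoneOn h T ∧ (∀ᵐ ω ∂P, Z ω ∈ T) ∧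
    P[Y | MeasurableSpace.comap Z inferInstance] =ᵐ[P] fun ω => h (Z ω)

/-- `E[Y | Z]` is a decreasing function of `Z`. -/
def CondExpDecreasing (P : Measure Ω) (Y Z : Ω → ℝ) : Prop :=
  ∃ (h : ℝ → ℝ) (T : Set ℝ), AntitoneOn h T ∧ (∀ᵐ ω ∂P, Z ω ∈ T) ∧
    P[Y | MeasurableSpace.comap Z inferInstance] =ᵐ[P] fun ω => h (Z ω)

/-- Positively regression dependent. -/
def IsPRD (P : Measure Ω) (X : Ω → Fin d → ℝ) : Prop :=
  ∀ (i : Fin d) (g : ({j : Fin d // j ≠ i} → ℝ) → ℝ),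
    Measurable g → Monotone g → Integrable (fun ω => g (omitCoord X i ω)) P →
    CondExpIncreasing P (fun ω => g (omitCoord X i ω)) (fun ω => X ω i)

/-- Negatively regression dependent. -/
def IsNRD (P : Measure Ω) (X : Ω → Fin d → ℝ) : Prop :=
  ∀ (i : Fin d) (g : ({j : Fin d // j ≠ i} → ℝ) → ℝ),
    Measurable g → Monotone g → Integrable (fun ω => g (omitCoord X i ω)) P →
    CondExpDecreasing P (fun ω => g (omitCoord X i ω)) (fun ω => X ω i)

/-- Weakly positively associated. -/
def IsWPA (P : Measure Ω) (X : Ω → Fin d → ℝ) : Prop :=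
  ∀ (i : Fin d) (S : Set ({j : Fin d // j ≠ i} → ℝ)) (x : ℝ),
    MeasurableSet S → IsLowerSet S → 0 < P {ω | X ω i ≤ x} →
    P {ω | omitCoord X i ω ∈ S} ≤
      (ProbabilityTheory.cond P {ω | X ω i ≤ x}) {ω | omitCoord X i ω ∈ S}

/-- Weakly negatively associated. -/
def IsWNA (P : Measure Ω) (X : Ω → Fin d → ℝ) : Prop :=
  ∀ (i : Fin d) (S : Set ({j : Fin d // j ≠ i} → ℝ)) (x : ℝ),
    MeasurableSet S → IsLowerSet S → 0 < P {ω | X ω i ≤ x} →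
    (ProbabilityTheory.cond P {ω | X ω i ≤ x}) {ω | omitCoord X i ω ∈ S} ≤
      P {ω | omitCoord X i ω ∈ S}

/-- Positively orthant dependent. -/
def IsPOD (P : Measure Ω) (X : Ω → Fin d → ℝ) : Prop :=
  ∀ x : Fin d → ℝ,
    (∏ i, P {ω | X ω i ≤ x i} ≤ P {ω | ∀ i, X ω i ≤ x i}) ∧
    (∏ i, P {ω | x i < X ω i} ≤ P {ω | ∀ i, x i < X ω i})

/-- Negatively orthant dependent. -/
def IsNOD (P : Measure Ω) (X : Ω → Fin d → ℝ) : Prop :=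
  ∀ x : Fin d → ℝ,
    (P {ω | ∀ i, X ω i ≤ x i} ≤ ∏ i, P {ω | X ω i ≤ x i}) ∧
    (P {ω | ∀ i, x i < X ω i} ≤ ∏ i, P {ω | x i < X ω i})

/-- The eight dependence concepts. -/
inductive Concept
  | PA | PRD | WPA | POD | NA | NRD | WNA | NOD

/-- The random vector `X` on `(Ω, P)` satisfies the dependence concept `D`. -/
def Satisfies (P : Measure Ω) (X : Ω → Fin d → ℝ) (D : Concept) : Prop :=
  match D with
  | .PA => IsPA P X
  | .PRD => IsPRD P X
  | .WPA => IsWPA P X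
  | .POD => IsPOD P X
  | .NA => IsNA P X
  | .NRD => IsNRD P X
  | .WNA => IsWNA P X
  | .NOD => IsNOD P X

/-- A distribution `C` on `ℝ^d` satisfies `D` if the random vector with distribution `C` does,
realized here as the identity map on `(ℝ^d, C)`. -/
def DistSatisfies (C : Measure (Fin d → ℝ)) (D : Concept) : Prop :=
  Satisfies C (fun u => u) D

/-! ### Copulas -/

/-- The uniform distribution on `[0,1]`. -/
def unif : Measure ℝ := volume.restrict (Icc 0 1)

instance instIsProbabilityMeasureUnif : IsProbabilityMeasure unif := by
  constructor
  simp [unif]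

/-- A copula, as a probability distribution on `ℝ^d` all of whose marginals are uniform on
`[0,1]`. -/
def IsCopula (C : Measure (Fin d → ℝ)) : Prop :=
  IsProbabilityMeasure C ∧ ∀ i, C.map (fun u => u i) = unif

/-- The marginal distribution function `F_i(t) = P(X_i ≤ t)`. -/
def margCDF (P : Measure Ω) (X : Ω → Fin d → ℝ) (i : Fin d) (t : ℝ) : ℝ :=
  P.real {ω | X ω i ≤ t}

/-- The left limit `F_i(t-) = P(X_i < t)`. -/
def margCDFLeft (P : Measure Ω) (X : Ω → Fin d → ℝ) (i : Fin d) (t : ℝ) : ℝ :=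
  P.real {ω | X ω i < t}

/-- `C` is a copula of `X`: it is a copula, and its distribution function satisfies
`P(X ≤ x) = C(F_1(x_1), …, F_d(x_d))` for all `x ∈ ℝ^d`. -/
def IsCopulaOf (C : Measure (Fin d → ℝ)) (P : Measure Ω) (X : Ω → Fin d → ℝ) : Prop :=
  IsCopula C ∧ ∀ x : Fin d → ℝ,
    P.real {ω | ∀ i, X ω i ≤ x i} = C.real {u | ∀ i, u i ≤ margCDF P X i (x i)}

/-- The probability integral transform
`U_i = F_i(x_i-) + v_i (F_i(x_i) - F_i(x_i-))`, `i = 1, …, d`. -/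
def integralTransform (P : Measure Ω) (X : Ω → Fin d → ℝ) (x v : Fin d → ℝ) : Fin d → ℝ :=
  fun i => margCDFLeft P X i (x i) + v i * (margCDF P X i (x i) - margCDFLeft P X i (x i))

/-- The checkerboard copula of `X`: the distribution of the probability integral transform of `X`
with `V` uniform on `[0,1]^d` and independent of `X`, realized on the product of `(Ω, P)` with
`[0,1]^d`. -/
def checkerboard (P : Measure Ω) (X : Ω → Fin d → ℝ) : Measure (Fin d → ℝ) :=
  (P.prod (Measure.pi fun _ : Fin d => unif)).map
    fun p => integralTransform P X (X p.1) p.2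

end CopulaDependence

end

/-! Two maps link a law `μ` on `ℝ^d` to its copulas. The distributional transform `T(x, v)`, with
coordinates `F_i(x_i-) + v_i (F_i(x_i) - F_i(x_i-))`, is increasing in `x` for each fixed `v` in the
cube. The quantile map `Q` is increasing on the open cube and satisfies `Q_i(u) ≤ t ↔ u ≤ F_i(t)`.
If `X` has law `μ` and `V` is uniform and independent of `X`, each coordinate of `U = T(X, V)` is
uniform and `Q(U) = X` almost surely; hence the law of `U` is a copula of `X`
(`real_Iic_eq_lawCheckerboard`). Conversely, `Q` pushes every copula of `X` forward to `μ`
(`map_vecQuantile`).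

Six of the concepts are product inequalities `JointIneq` for monotone sets depending on prescribed
blocks of coordinates: two blocks and upper sets for PA and NA, the blocks `{i}` and `{i}ᶜ` and
lower sets for WPA and WNA, singletons with both kinds of sets for POD and NOD. Such an inequality
passes from a copula to `μ` because pulling back along `Q` keeps monotonicity and blocks
(`JointIneq.of_copula`). In the other direction, fix `v`: preimages under `T(·, v)` are again
monotone sets with the same blocks, so the inequality for `μ` holds slice by slice, and one
integrates over `v`. The integral of the product of slice probabilities must then be compared with
the product of the integrals. For disjoint blocks they agree by independence of the `V_k`, whatever
the sign. Only PA allows overlapping blocks, and there Harris' inequality for the cube gives the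
required direction.

PRD and NRD concern conditional expectations, which are characterised by bounded test functions of
the conditioning variable (`condExpIncreasing_iff`). From a copula to `μ`, conditioning on `U_i` is
coarsened to conditioning on `Q_i(U_i)`; the regression function is averaged over the jump intervals
of `F_i`, which are ordered, so it stays monotone. From `μ` to the checkerboard copula, averaging
`g(U_{-i})` over `V` gives an increasing function of `X_{-i}`, whose regression function on `X_i` is
composed with `Q_i`. -/

namespace CopulaDependence

/-! ### The distributional transform and the quantile function of a law on `ℝ` -/

section OneDim

/-- The distributional transform `F(x-) + v (F(x) - F(x-))` of a law `ν` on `ℝ`. -/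
noncomputable def distTransform (ν : Measure ℝ) (x v : ℝ) : ℝ :=
  ν.real (Iio x) + v * (ν.real (Iic x) - ν.real (Iio x))

open Classical in
/-- The quantile function of a law `ν` on `ℝ`, set to `0` outside of `(0,1)`. -/
noncomputable def quantile (ν : Measure ℝ) (u : ℝ) : ℝ :=
  if u ∈ Ioo (0 : ℝ) 1 then sInf {t | u ≤ ν.real (Iic t)} else 0

variable (ν : Measure ℝ) [IsProbabilityMeasure ν]

lemma monotone_real_Iic : Monotone fun t => ν.real (Iic t) :=
  fun _ _ h => measureReal_mono (Iic_subset_Iic.2 h)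

lemma monotone_real_Iio : Monotone fun t => ν.real (Iio t) :=
  fun _ _ h => measureReal_mono (Iio_subset_Iio h)

lemma real_Iio_le_real_Iic (t : ℝ) : ν.real (Iio t) ≤ ν.real (Iic t) :=
  measureReal_mono Iio_subset_Iic_self

lemma real_Iic_le_real_Iio {s t : ℝ} (h : s < t) : ν.real (Iic s) ≤ ν.real (Iio t) :=
  measureReal_mono fun _ hx => lt_of_le_of_lt hx h

lemma real_Iic_eq_add (t : ℝ) : ν.real (Iic t) = ν.real (Iio t) + ν.real {t} := by
  rw [← Iio_union_right, measureReal_union (by simp) (measurableSet_singleton t)]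

lemma distTransform_le {x v : ℝ} (hv : v ≤ 1) : distTransform ν x v ≤ ν.real (Iic x) := by
  have := real_Iio_le_real_Iic ν x
  unfold distTransform
  nlinarith

lemma le_distTransform {x v : ℝ} (hv : 0 ≤ v) : ν.real (Iio x) ≤ distTransform ν x v := by
  have := real_Iio_le_real_Iic ν x
  unfold distTransform
  nlinarith

/-- The jump intervals `[F(x-), F(x)]` are ordered: for `x < y`, everything attained at `x` is at
most `F(x) ≤ F(y-)`, a lower bound for everything attained at `y`. -/
lemma distTransform_mono_left {v : ℝ} (hv : v ∈ Icc (0 : ℝ) 1) :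
    Monotone fun x => distTransform ν x v := by
  intro x y h
  rcases h.eq_or_lt with rfl | h
  · exact le_rfl
  · exact (distTransform_le ν hv.2).trans
      ((real_Iic_le_real_Iio ν h).trans (le_distTransform ν hv.1))

lemma distTransform_mono_right (x : ℝ) : Monotone fun v => distTransform ν x v := by
  intro v w h
  have := real_Iio_le_real_Iic ν x
  simp only [distTransform]
  nlinarith

lemma measurable_distTransform : Measurable fun p : ℝ × ℝ => distTransform ν p.1 p.2 := by
  have h1 := (monotone_real_Iic ν).measurable
  have h2 := (monotone_real_Iio ν).measurable
  unfold distTransform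
  exact (h2.comp measurable_fst).add
    (measurable_snd.mul ((h1.comp measurable_fst).sub (h2.comp measurable_fst)))

lemma tendsto_real_Iic_atBot : Filter.Tendsto (fun t => ν.real (Iic t)) Filter.atBot (nhds 0) := by
  exact (tendsto_cdf_atBot ν).congr (cdf_eq_real ν)

lemma tendsto_real_Iic_atTop : Filter.Tendsto (fun t => ν.real (Iic t)) Filter.atTop (nhds 1) := by
  exact (tendsto_cdf_atTop ν).congr (cdf_eq_real ν)

/-- The Galois connection between the quantile function and the distribution function. -/
lemma quantile_le_iff {u t : ℝ} (hu : u ∈ Ioo (0 : ℝ) 1) :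
    quantile ν u ≤ t ↔ u ≤ ν.real (Iic t) := by
  have hne : {t | u ≤ ν.real (Iic t)}.Nonempty := by
    obtain ⟨t, ht⟩ := ((tendsto_real_Iic_atTop ν).eventually (lt_mem_nhds hu.2)).exists
    exact ⟨t, ht.le⟩
  have hbdd : BddBelow {t | u ≤ ν.real (Iic t)} := by
    obtain ⟨t, ht⟩ := ((tendsto_real_Iic_atBot ν).eventually (gt_mem_nhds hu.1)).exists
    refine ⟨t, fun s hs => ?_⟩
    by_contra hst
    exact absurd (hs.trans (monotone_real_Iic ν (not_le.1 hst).le)) (not_le.2 ht)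
  -- The infimum is attained, by right continuity of the distribution function.
  have hcl : u ≤ ν.real (Iic (sInf {t | u ≤ ν.real (Iic t)})) := by
    have hc : ContinuousWithinAt (fun t => ν.real (Iic t)) (Ioi (sInf {t | u ≤ ν.real (Iic t)}))
        (sInf {t | u ≤ ν.real (Iic t)}) := by
      have := ((cdf ν).right_continuous (sInf {t | u ≤ ν.real (Iic t)})).mono Ioi_subset_Ici_self
      exact this.congr (fun t _ => (cdf_eq_real ν t).symm) (cdf_eq_real ν _).symm
    refine ge_of_tendsto hc ?_
    filter_upwards [self_mem_nhdsWithin] with s hs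
    obtain ⟨r, hr, hrs⟩ := exists_lt_of_csInf_lt hne hs
    exact le_trans hr (monotone_real_Iic ν hrs.le)
  rw [quantile, if_pos hu]
  exact ⟨fun h => hcl.trans (monotone_real_Iic ν h), fun h => csInf_le hbdd h⟩

lemma quantile_monotoneOn : MonotoneOn (quantile ν) (Ioo 0 1) := fun _ hu _ hw h =>
  (quantile_le_iff ν hu).2 (h.trans ((quantile_le_iff ν hw).1 le_rfl))

lemma measurable_quantile : Measurable (quantile ν) := by
  refine measurable_of_Iic fun t => ?_
  have : quantile ν ⁻¹' Iic t =
      (Ioo 0 1 ∩ Iic (ν.real (Iic t))) ∪ ((Ioo 0 1)ᶜ ∩ {_u | 0 ≤ t}) := by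
    ext u
    by_cases hu : u ∈ Ioo (0 : ℝ) 1
    · simp only [mem_preimage, mem_Iic, quantile_le_iff ν hu, mem_union, mem_inter_iff, hu,
        mem_compl_iff, not_true, false_and, true_and, or_false]
    · simp only [mem_preimage, mem_Iic, quantile, mem_union, mem_inter_iff, hu, if_false,
        mem_compl_iff, not_false_iff, false_and, true_and, false_or, mem_ofPred_eq]
  rw [this]
  exact (measurableSet_Ioo.inter measurableSet_Iic).union
    (measurableSet_Ioo.compl.inter (MeasurableSet.const _))

lemma ae_unif_mem_Icc : ∀ᵐ u ∂unif, u ∈ Icc (0 : ℝ) 1 := by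
  rw [unif]
  exact ae_restrict_mem measurableSet_Icc

lemma ae_unif_mem_Ioo : ∀ᵐ u ∂unif, u ∈ Ioo (0 : ℝ) 1 := by
  rw [unif, ← restrict_Ioo_eq_restrict_Icc]
  exact ae_restrict_mem measurableSet_Ioo

lemma unif_real_Iic {u : ℝ} (hu : u ∈ Icc (0 : ℝ) 1) : unif.real (Iic u) = u := by
  have : Iic u ∩ Icc 0 1 = Icc 0 u := by
    ext x
    simp only [mem_inter_iff, mem_Iic, mem_Icc]
    constructor
    · rintro ⟨h, h', -⟩; exact ⟨h', h⟩
    · rintro ⟨h, h'⟩; exact ⟨h', h, h'.trans hu.2⟩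
  rw [measureReal_def, unif, Measure.restrict_apply measurableSet_Iic, this, Real.volume_Icc,
    sub_zero, ENNReal.toReal_ofReal hu.1]

lemma unif_real_Iio {u : ℝ} (hu : u ∈ Icc (0 : ℝ) 1) : unif.real (Iio u) = u := by
  have : unif (Iio u) = unif (Iic u) := by
    have : NullSingletonClass unif := by unfold unif; infer_instance
    exact measure_congr Iio_ae_eq_Iic
  rw [measureReal_def, this, ← measureReal_def, unif_real_Iic hu]

/-- A probability measure on `ℝ` is uniform as soon as its distribution function is bracketed
by the identity on `(0,1)`. -/
lemma eq_unif_of_real_Iio_le {ρ : Measure ℝ} [IsProbabilityMeasure ρ]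
    (h1 : ∀ u ∈ Ioo (0 : ℝ) 1, ρ.real (Iio u) ≤ u) (h2 : ∀ u ∈ Ioo (0 : ℝ) 1, u ≤ ρ.real (Iic u)) :
    ρ = unif := by
  -- For `w > u` one has `ρ (Iic u) ≤ ρ (Iio w) ≤ w`; let `w` decrease to `u`.
  have key : ∀ u ∈ Ioo (0 : ℝ) 1, ρ.real (Iic u) = u := by
    intro u hu
    refine le_antisymm (le_of_forall_gt_imp_ge_of_dense fun w hw => ?_) (h2 u hu)
    rcases lt_or_ge w 1 with h | h
    · exact (real_Iic_le_real_Iio ρ hw).trans (h1 w ⟨hu.1.trans hw, h⟩)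
    · exact measureReal_le_one.trans h
  refine Measure.ext_of_Iic _ _ fun u => ?_
  rw [← measureReal_eq_measureReal_iff]
  -- Outside `(0,1)` the values are forced by monotonicity. The `1 / 2` here and in `htop` keeps the
  -- comparison point inside `(0,1)`.
  have hbot : ∀ {σ : Measure ℝ} [IsProbabilityMeasure σ],
      (∀ u ∈ Ioo (0 : ℝ) 1, σ.real (Iic u) = u) → ∀ u ≤ 0, σ.real (Iic u) = 0 := by
    intro σ _ hσ u hu
    refine le_antisymm (le_of_forall_gt_imp_ge_of_dense fun w hw => ?_) measureReal_nonneg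
    have hm : min w (1 / 2) ∈ Ioo (0 : ℝ) 1 :=
      ⟨lt_min hw (by norm_num), (min_le_right _ _).trans_lt (by norm_num)⟩
    calc σ.real (Iic u) ≤ σ.real (Iic (min w (1 / 2))) := monotone_real_Iic σ (hu.trans hm.1.le)
      _ ≤ w := by rw [hσ _ hm]; exact min_le_left _ _
  have htop : ∀ {σ : Measure ℝ} [IsProbabilityMeasure σ],
      (∀ u ∈ Ioo (0 : ℝ) 1, σ.real (Iic u) = u) → ∀ u ≥ 1, σ.real (Iic u) = 1 := by
    intro σ _ hσ u hu
    refine le_antisymm measureReal_le_one (le_of_forall_lt_imp_le_of_dense fun w hw => ?_)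
    have hm : max w (1 / 2) ∈ Ioo (0 : ℝ) 1 :=
      ⟨lt_max_of_lt_right (by norm_num), max_lt hw (by norm_num)⟩
    calc w ≤ σ.real (Iic (max w (1 / 2))) := by rw [hσ _ hm]; exact le_max_left _ _
      _ ≤ σ.real (Iic u) := monotone_real_Iic σ (hm.2.le.trans hu)
  have hunif : ∀ u ∈ Ioo (0 : ℝ) 1, unif.real (Iic u) = u :=
    fun u hu => unif_real_Iic (Ioo_subset_Icc_self hu)
  rcases le_or_gt u 0 with h0 | h0
  · rw [hbot key u h0, hbot hunif u h0]
  rcases lt_or_ge u 1 with h | h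
  · rw [key u ⟨h0, h⟩, hunif u ⟨h0, h⟩]
  · rw [htop key u h, htop hunif u h]

/-- Every level `u` lies in the jump interval at its quantile `q`: points `t < q` have `F(t) < u` by
the Galois connection, and `F(q-)` is the limit of `F` along a sequence increasing to `q`. -/
lemma quantile_jump {u : ℝ} (hu : u ∈ Ioo (0 : ℝ) 1) :
    ν.real (Iio (quantile ν u)) ≤ u ∧ u ≤ ν.real (Iic (quantile ν u)) := by
  refine ⟨?_, (quantile_le_iff ν hu).1 le_rfl⟩
  have hlt : ∀ t < quantile ν u, ν.real (Iic t) ≤ u := fun t ht =>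
    (not_le.1 fun h => absurd ((quantile_le_iff ν hu).2 h) (not_le.2 ht)).le
  obtain ⟨a, hsm, ha, hlim⟩ := exists_seq_strictMono_tendsto (quantile ν u)
  have hU : Iio (quantile ν u) = ⋃ n, Iic (a n) := by
    ext x
    simp only [mem_Iio, mem_iUnion, mem_Iic]
    constructor
    · intro hx
      obtain ⟨n, hn⟩ := (hlim.eventually (lt_mem_nhds hx)).exists
      exact ⟨n, hn.le⟩
    · rintro ⟨n, hn⟩
      exact hn.trans_lt (ha n)
  have hmono : Monotone fun n => Iic (a n) := fun m n h =>
    Iic_subset_Iic.2 (hsm.monotone h)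
  have : Filter.Tendsto (fun n => ν.real (Iic (a n))) Filter.atTop
      (nhds (ν.real (Iio (quantile ν u)))) := by
    rw [hU]
    exact (ENNReal.tendsto_toReal (measure_ne_top _ _)).comp (tendsto_measure_iUnion_atTop hmono)
  exact le_of_tendsto' this fun n => hlt _ (ha n)

/-- The distributional transform of `ν` with an independent uniform variable is uniform. -/
lemma map_distTransform :
    (ν.prod unif).map (fun p : ℝ × ℝ => distTransform ν p.1 p.2) = unif := by
  have hm := measurable_distTransform ν
  have : IsProbabilityMeasure ((ν.prod unif).map (fun p : ℝ × ℝ => distTransform ν p.1 p.2)) :=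
    Measure.isProbabilityMeasure_map hm.aemeasurable
  -- `θ` is the fraction of the jump at the quantile that lies below `u`. Without an atom there its
  -- value is immaterial, and `0` serves.
  have main : ∀ u ∈ Ioo (0 : ℝ) 1, ∃ θ ∈ Icc (0 : ℝ) 1,
      ν.real (Iio (quantile ν u)) + θ * ν.real {quantile ν u} = u := by
    intro u hu
    obtain ⟨h1, h2⟩ := quantile_jump ν hu
    rw [real_Iic_eq_add] at h2
    rcases (measureReal_nonneg (μ := ν) (s := {quantile ν u})).eq_or_lt with h | h
    · exact ⟨0, by simp, by linarith⟩
    · refine ⟨(u - ν.real (Iio (quantile ν u))) / ν.real {quantile ν u},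
        ⟨div_nonneg (by linarith) h.le, (div_le_one h).2 (by linarith)⟩, ?_⟩
      field_simp
      ring
  -- With `a` the quantile of `u`, this set has measure `u` both for `I = Iio θ` and for `I = Iic
  -- θ`. Up to null sets, the first contains the event that the transform is `< u`, and the second
  -- is contained in the event that it is `≤ u`.
  have hval : ∀ (a θ : ℝ) (I : Set ℝ), MeasurableSet I → unif.real I = θ →
      (ν.prod unif).real (Iio a ×ˢ univ ∪ {a} ×ˢ I) = ν.real (Iio a) + θ * ν.real {a} := by
    intro a θ I hI hθ
    rw [measureReal_union _ ((measurableSet_singleton a).prod hI), measureReal_prod_prod,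
      measureReal_prod_prod, hθ, probReal_univ, mul_one, mul_comm θ]
    rw [Set.disjoint_left]
    rintro ⟨x, v⟩ h h'
    simp only [mem_prod, mem_Iio, mem_singleton_iff] at h h'
    exact absurd h.1 (by simp [h'.1])
  have hIcc : ∀ᵐ p ∂ν.prod unif, p.2 ∈ Icc (0 : ℝ) 1 :=
    Measure.quasiMeasurePreserving_snd.ae ae_unif_mem_Icc
  refine eq_unif_of_real_Iio_le (fun u hu => ?_) fun u hu => ?_
  · obtain ⟨θ, hθ, heq⟩ := main u hu
    rw [map_measureReal_apply hm measurableSet_Iio]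
    conv_rhs => rw [← heq, ← hval _ θ (Iio θ) measurableSet_Iio (unif_real_Iio hθ)]
    refine ENNReal.toReal_mono (measure_ne_top _ _) (measure_mono_ae ?_)
    filter_upwards [hIcc] with p hp hpu
    have hpu : distTransform ν p.1 p.2 < u := hpu
    rcases lt_trichotomy p.1 (quantile ν u) with h | h | h
    · exact Or.inl ⟨h, mem_univ _⟩
    · refine Or.inr ⟨h, ?_⟩
      by_contra hc
      have hc : θ ≤ p.2 := not_lt.1 hc
      rw [h, distTransform, real_Iic_eq_add] at hpu
      have := mul_le_mul_of_nonneg_right hc (measureReal_nonneg (μ := ν) (s := {quantile ν u}))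
      linarith
    · have := (quantile_jump ν hu).2.trans ((real_Iic_le_real_Iio ν h).trans
        (le_distTransform ν hp.1))
      exact absurd hpu (not_lt.2 this)
  · obtain ⟨θ, hθ, heq⟩ := main u hu
    rw [map_measureReal_apply hm measurableSet_Iic]
    conv_lhs => rw [← heq, ← hval _ θ (Iic θ) measurableSet_Iic (unif_real_Iic hθ)]
    refine ENNReal.toReal_mono (measure_ne_top _ _) (measure_mono_ae ?_)
    filter_upwards [hIcc] with p hp hpu
    rcases hpu with ⟨h, -⟩ | ⟨h, hv⟩
    · refine (distTransform_le ν hp.2).trans ?_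
      exact (not_le.1 fun h' => absurd ((quantile_le_iff ν hu).2 h') (not_le.2 h)).le
    · have h : p.1 = quantile ν u := h
      have hv : p.2 ≤ θ := hv
      change distTransform ν p.1 p.2 ≤ u
      rw [h, distTransform, real_Iic_eq_add]
      have := mul_le_mul_of_nonneg_right hv (measureReal_nonneg (μ := ν) (s := {quantile ν u}))
      linarith

lemma map_quantile : unif.map (quantile ν) = ν := by
  have : IsProbabilityMeasure (unif.map (quantile ν)) :=
    Measure.isProbabilityMeasure_map (measurable_quantile ν).aemeasurable
  refine Measure.ext_of_Iic _ _ fun t => ?_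
  rw [← measureReal_eq_measureReal_iff, map_measureReal_apply (measurable_quantile ν)
    measurableSet_Iic, ← unif_real_Iic (u := ν.real (Iic t)) ⟨measureReal_nonneg, measureReal_le_one⟩]
  refine measureReal_congr ?_
  filter_upwards [ae_unif_mem_Ioo] with u hu
  exact propext (quantile_le_iff ν hu)

lemma ae_distTransform_mem_Ioo :
    ∀ᵐ p ∂ν.prod unif, distTransform ν p.1 p.2 ∈ Ioo (0 : ℝ) 1 := by
  have h := ae_unif_mem_Ioo
  rw [← map_distTransform ν] at h
  exact ae_of_ae_map (measurable_distTransform ν).aemeasurable h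

/-- The quantile function almost surely inverts the distributional transform. -/
lemma ae_quantile_distTransform :
    ∀ᵐ p ∂ν.prod unif, quantile ν (distTransform ν p.1 p.2) = p.1 := by
  have hm := measurable_distTransform ν
  have hq := measurable_quantile ν
  -- The composite and the first coordinate have the same law and one is almost surely below the
  -- other, which forces equality: at each rational level the nested events have equal mass, and a
  -- rational strictly between the two values would separate them.
  have hW : (ν.prod unif).map (fun p : ℝ × ℝ => quantile ν (distTransform ν p.1 p.2)) = ν := by
    have h := Measure.map_map (μ := ν.prod unif) hq hm
    rw [map_distTransform, map_quantile] at h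
    exact h.symm
  have hfst : (ν.prod unif).map Prod.fst = ν := by simp
  have hle : ∀ᵐ p ∂ν.prod unif, quantile ν (distTransform ν p.1 p.2) ≤ p.1 := by
    filter_upwards [ae_distTransform_mem_Ioo ν,
      Measure.quasiMeasurePreserving_snd.ae ae_unif_mem_Icc] with p hp hp2
    exact (quantile_le_iff ν hp).2 (distTransform_le ν hp2.2)
  have hq0 : ∀ r : ℚ, ∀ᵐ p ∂ν.prod unif,
      quantile ν (distTransform ν p.1 p.2) ≤ (r : ℝ) → p.1 ≤ (r : ℝ) := by
    intro r
    have hsub : (Prod.fst ⁻¹' Iic (r : ℝ) : Set (ℝ × ℝ)) ≤ᵐ[ν.prod unif]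
        ((fun p : ℝ × ℝ => quantile ν (distTransform ν p.1 p.2)) ⁻¹' Iic (r : ℝ) : Set (ℝ × ℝ)) := by
      filter_upwards [hle] with p hp h
      exact le_trans hp h
    have hEq := ae_eq_of_ae_subset_of_measure_ge hsub (by
      rw [← Measure.map_apply (f := fun p : ℝ × ℝ => quantile ν (distTransform ν p.1 p.2))
        (hq.comp hm) measurableSet_Iic, hW,
        ← Measure.map_apply measurable_fst measurableSet_Iic, hfst])
      (measurable_fst measurableSet_Iic).nullMeasurableSet (measure_ne_top _ _)
    filter_upwards [hEq] with p hp h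
    exact hp.mpr h
  filter_upwards [hle, ae_all_iff.2 hq0] with p hp h
  refine le_antisymm hp (not_lt.1 fun hlt => ?_)
  obtain ⟨r, h1, h2⟩ := exists_rat_btwn hlt
  exact absurd (h r h1.le) (not_le.2 h2)

end OneDim

/-! ### The checkerboard copula and quantile transforms of a law on `ℝ^d` -/

section Vector

variable {Ω : Type*} [MeasurableSpace Ω] {d : ℕ}

/-- The `i`-th marginal of a law on `ℝ^d`. -/
noncomputable def marg (μ : Measure (Fin d → ℝ)) (i : Fin d) : Measure ℝ := μ.map fun x => x i

/-- The uniform distribution on `[0,1]^d`. -/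
noncomputable def cube (d : ℕ) : Measure (Fin d → ℝ) := Measure.pi fun _ : Fin d => unif

/-- The coordinatewise distributional transform of a law on `ℝ^d`. -/
noncomputable def vecTransform (μ : Measure (Fin d → ℝ)) (x v : Fin d → ℝ) : Fin d → ℝ :=
  fun i => distTransform (marg μ i) (x i) (v i)

/-- The coordinatewise quantile function of a law on `ℝ^d`. -/
noncomputable def vecQuantile (μ : Measure (Fin d → ℝ)) (u : Fin d → ℝ) : Fin d → ℝ :=
  fun i => quantile (marg μ i) (u i)

/-- The checkerboard copula of a law on `ℝ^d`. -/
noncomputable def lawCheckerboard (μ : Measure (Fin d → ℝ)) : Measure (Fin d → ℝ) :=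
  (μ.prod (cube d)).map fun p => vecTransform μ p.1 p.2

instance : IsProbabilityMeasure (cube d) := by unfold cube; infer_instance

lemma measurableSet_forall_le (a : Fin d → ℝ) : MeasurableSet {y : Fin d → ℝ | ∀ i, y i ≤ a i} :=
  measurableSet_Iic (a := a)

lemma measurePreserving_eval_cube (i : Fin d) :
    MeasurePreserving (fun v : Fin d → ℝ => v i) (cube d) unif :=
  measurePreserving_eval (fun _ : Fin d => unif) i

lemma ae_cube_mem_Icc : ∀ᵐ v ∂cube d, ∀ i, v i ∈ Icc (0 : ℝ) 1 :=
  ae_all_iff.2 fun i => (measurePreserving_eval_cube i).quasiMeasurePreserving.ae ae_unif_mem_Icc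

variable (μ : Measure (Fin d → ℝ)) [IsProbabilityMeasure μ]

instance (i : Fin d) : IsProbabilityMeasure (marg μ i) :=
  Measure.isProbabilityMeasure_map (measurable_pi_apply i).aemeasurable

lemma measurable_vecTransform :
    Measurable fun p : (Fin d → ℝ) × (Fin d → ℝ) => vecTransform μ p.1 p.2 :=
  measurable_pi_lambda _ fun i =>
    (measurable_distTransform (marg μ i)).comp (g := fun p : ℝ × ℝ => distTransform _ p.1 p.2)
      (f := fun p : (Fin d → ℝ) × (Fin d → ℝ) => (p.1 i, p.2 i))
      (((measurable_pi_apply i).comp measurable_fst).prodMk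
        ((measurable_pi_apply i).comp measurable_snd))

lemma measurable_vecQuantile : Measurable (vecQuantile μ) :=
  measurable_pi_lambda _ fun i => (measurable_quantile (marg μ i)).comp (measurable_pi_apply i)

lemma vecTransform_mono_left {v : Fin d → ℝ} (hv : ∀ i, v i ∈ Icc (0 : ℝ) 1) :
    Monotone fun x => vecTransform μ x v :=
  fun _ _ h i => distTransform_mono_left (marg μ i) (hv i) (h i)

lemma vecTransform_mono_right (x : Fin d → ℝ) : Monotone fun v => vecTransform μ x v :=
  fun _ _ h i => distTransform_mono_right (marg μ i) (x i) (h i)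

instance : IsProbabilityMeasure (lawCheckerboard μ) :=
  Measure.isProbabilityMeasure_map (measurable_vecTransform μ).aemeasurable

lemma measurePreserving_vecTransform :
    MeasurePreserving (fun p : (Fin d → ℝ) × (Fin d → ℝ) => vecTransform μ p.1 p.2)
      (μ.prod (cube d)) (lawCheckerboard μ) :=
  ⟨measurable_vecTransform μ, rfl⟩

lemma measurePreserving_coord (i : Fin d) :
    MeasurePreserving (fun p : (Fin d → ℝ) × (Fin d → ℝ) => (p.1 i, p.2 i))
      (μ.prod (cube d)) ((marg μ i).prod unif) :=
  MeasurePreserving.prod (f := fun x : Fin d → ℝ => x i) (g := fun v : Fin d → ℝ => v i)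
    ⟨measurable_pi_apply i, rfl⟩ (measurePreserving_eval_cube i)

lemma ae_vecTransform_mem_Ioo :
    ∀ᵐ p ∂μ.prod (cube d), ∀ i, vecTransform μ p.1 p.2 i ∈ Ioo (0 : ℝ) 1 :=
  ae_all_iff.2 fun i => (measurePreserving_coord μ i).quasiMeasurePreserving.ae
    (ae_distTransform_mem_Ioo (marg μ i))

lemma ae_vecQuantile_vecTransform :
    ∀ᵐ p ∂μ.prod (cube d), vecQuantile μ (vecTransform μ p.1 p.2) = p.1 := by
  filter_upwards [ae_all_iff.2 fun i => (measurePreserving_coord μ i).quasiMeasurePreserving.ae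
    (ae_quantile_distTransform (marg μ i))] with p hp
  exact funext hp

lemma lawCheckerboard_map_eval (i : Fin d) :
    (lawCheckerboard μ).map (fun u => u i) = unif := by
  rw [lawCheckerboard, Measure.map_map (measurable_pi_apply i) (measurable_vecTransform μ)]
  have h := Measure.map_map (μ := μ.prod (cube d)) (measurable_distTransform (marg μ i))
    (measurePreserving_coord μ i).measurable
  rw [(measurePreserving_coord μ i).map_eq, map_distTransform] at h
  exact h.symm

lemma isCopula_lawCheckerboard : IsCopula (lawCheckerboard μ) :=
  ⟨inferInstance, lawCheckerboard_map_eval μ⟩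

/-- Almost surely `X_i = Q_i(U_i)`, so the Galois connection turns `X_i ≤ x_i` into `U_i ≤
F_i(x_i)`. -/
lemma real_Iic_eq_lawCheckerboard (x : Fin d → ℝ) :
    μ.real {y | ∀ i, y i ≤ x i} =
      (lawCheckerboard μ).real {u | ∀ i, u i ≤ (marg μ i).real (Iic (x i))} := by
  have h1 : μ.real {y | ∀ i, y i ≤ x i} = (μ.prod (cube d)).real {p | ∀ i, p.1 i ≤ x i} := by
    conv_lhs => rw [← (measurePreserving_fst (μ := μ) (ν := cube d)).map_eq]
    exact map_measureReal_apply measurable_fst (measurableSet_forall_le x)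
  rw [h1, lawCheckerboard, map_measureReal_apply (measurable_vecTransform μ) (measurableSet_forall_le _)]
  refine measureReal_congr ?_
  filter_upwards [ae_vecTransform_mem_Ioo μ, ae_vecQuantile_vecTransform μ] with p h1 h2
  refine propext (forall_congr' fun i => ?_)
  change _ ↔ vecTransform μ p.1 p.2 i ≤ _
  rw [← quantile_le_iff _ (h1 i)]
  exact iff_of_eq (congrArg (· ≤ x i) (congrFun h2 i).symm)

variable {μ}

lemma IsCopula.ae_mem_Ioo {C : Measure (Fin d → ℝ)} (hC : IsCopula C) :
    ∀ᵐ u ∂C, ∀ i, u i ∈ Ioo (0 : ℝ) 1 := by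
  refine ae_all_iff.2 fun i => ?_
  have h := ae_unif_mem_Ioo
  rw [← hC.2 i] at h
  exact ae_of_ae_map (measurable_pi_apply i).aemeasurable h

/-- Two probability measures on `ℝ^d` with the same distribution function agree. -/
lemma eq_of_real_Iic {μ' : Measure (Fin d → ℝ)} [IsProbabilityMeasure μ']
    (h : ∀ x : Fin d → ℝ, μ.real {y | ∀ i, y i ≤ x i} = μ'.real {y | ∀ i, y i ≤ x i}) :
    μ = μ' := by
  refine ext_of_generate_finite (pi univ '' pi univ fun _ : Fin d => range (Iic : ℝ → Set ℝ))
    ?_ (IsPiSystem.pi fun _ => isPiSystem_Iic) ?_ (by simp)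
  · rw [← generateFrom_pi_eq]
    · rw [← borel_eq_generateFrom_Iic ℝ, ← BorelSpace.measurable_eq (α := ℝ)]
    · refine fun _ => ⟨fun n => Iic n, fun n => ⟨n, rfl⟩, ?_⟩
      exact iUnion_Iic_of_not_bddAbove_range (fun ⟨b, hb⟩ => by
        obtain ⟨n, hn⟩ := exists_nat_gt b
        exact absurd (hb ⟨n, rfl⟩) (not_le.2 hn))
  · rintro _ ⟨s, hs, rfl⟩
    choose x hx using fun i => hs i (mem_univ i)
    have : pi univ s = {y | ∀ i, y i ≤ x i} := by
      ext y
      simp [mem_pi, ← hx]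
    rw [this, ← measureReal_eq_measureReal_iff]
    exact h x

/-- By the Galois connection the event `Q(u) ≤ x` is `u ≤ F(x)` for `C`-almost every `u`, so the
copula identity says that both laws have the same distribution function. No uniqueness of `C` is
involved. -/
lemma map_vecQuantile {C : Measure (Fin d → ℝ)} (hC : IsCopula C)
    (h : ∀ x : Fin d → ℝ, μ.real {y | ∀ i, y i ≤ x i} =
      C.real {u | ∀ i, u i ≤ (marg μ i).real (Iic (x i))}) :
    C.map (vecQuantile μ) = μ := by
  have := hC.1
  have : IsProbabilityMeasure (C.map (vecQuantile μ)) :=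
    Measure.isProbabilityMeasure_map (measurable_vecQuantile μ).aemeasurable
  refine eq_of_real_Iic fun x => ?_
  rw [map_measureReal_apply (measurable_vecQuantile μ) (measurableSet_forall_le x), h x]
  refine measureReal_congr ?_
  filter_upwards [hC.ae_mem_Ioo] with u hu
  exact propext (forall_congr' fun i => quantile_le_iff _ (hu i))

/-! Translation between a random vector and its law. -/

variable {P : Measure Ω} {X : Ω → Fin d → ℝ}

lemma margCDF_eq (hX : Measurable X) (i : Fin d) (t : ℝ) :
    margCDF P X i t = (marg (P.map X) i).real (Iic t) := by
  rw [marg, Measure.map_map (measurable_pi_apply i) hX,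
    map_measureReal_apply ((measurable_pi_apply i).comp hX) measurableSet_Iic]
  rfl

lemma margCDFLeft_eq (hX : Measurable X) (i : Fin d) (t : ℝ) :
    margCDFLeft P X i t = (marg (P.map X) i).real (Iio t) := by
  rw [marg, Measure.map_map (measurable_pi_apply i) hX,
    map_measureReal_apply ((measurable_pi_apply i).comp hX) measurableSet_Iio]
  rfl

lemma checkerboard_eq_lawCheckerboard [IsProbabilityMeasure P] (hX : Measurable X) :
    checkerboard P X = lawCheckerboard (P.map X) := by
  have hprod : (P.map X).prod (cube d) = (P.prod (cube d)).map (Prod.map X id) := by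
    have := Measure.isProbabilityMeasure_map (μ := P) hX.aemeasurable
    rw [← Measure.map_prod_map _ _ hX measurable_id, Measure.map_id]
  have := Measure.isProbabilityMeasure_map (μ := P) hX.aemeasurable
  rw [lawCheckerboard, hprod,
    Measure.map_map (measurable_vecTransform _) (hX.prodMap measurable_id), checkerboard]
  congr 1
  ext p i
  simp only [integralTransform, margCDF_eq hX, margCDFLeft_eq hX]
  rfl

lemma isCopulaOf_iff (hX : Measurable X) (C : Measure (Fin d → ℝ)) :
    IsCopulaOf C P X ↔ IsCopula C ∧ ∀ x : Fin d → ℝ, (P.map X).real {y | ∀ i, y i ≤ x i} =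
      C.real {u | ∀ i, u i ≤ (marg (P.map X) i).real (Iic (x i))} := by
  refine and_congr_right fun _ => forall_congr' fun x => ?_
  rw [map_measureReal_apply hX (measurableSet_forall_le x)]
  simp only [margCDF_eq hX]
  rfl

end Vector

/-! ### Independence and positive association of the uniform law on the cube -/

section Cube

variable {d : ℕ}

/-- The extension by zero of a vector indexed by a subset of the coordinates. -/
def extendZero (p : Fin d → Prop) [DecidablePred p] (z : {k // p k} → ℝ) : Fin d → ℝ :=
  fun k => if h : p k then z ⟨k, h⟩ else 0

lemma extendZero_apply (p : Fin d → Prop) [DecidablePred p] (z : {k // p k} → ℝ) {k : Fin d}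
    (h : p k) : extendZero p z k = z ⟨k, h⟩ := by
  simp [extendZero, h]

lemma measurable_extendZero (p : Fin d → Prop) [DecidablePred p] : Measurable (extendZero p) := by
  refine measurable_pi_lambda _ fun k => ?_
  by_cases h : p k
  · simpa only [extendZero, h, dite_true] using measurable_pi_apply _
  · simpa only [extendZero, h, dite_false] using measurable_const

lemma monotone_extendZero (p : Fin d → Prop) [DecidablePred p] : Monotone (extendZero p) := by
  intro z w hzw k
  by_cases h : p k
  · simpa only [extendZero, h, dite_true] using hzw _
  · simp only [extendZero, h, dite_false, le_refl]

lemma integrable_of_abs_le {Ω : Type*} [MeasurableSpace Ω] {P : Measure Ω} [IsFiniteMeasure P]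
    {f : Ω → ℝ} (hf : Measurable f) {M : ℝ} (hM : ∀ x, |f x| ≤ M) : Integrable f P :=
  Integrable.of_bound hf.aestronglyMeasurable M (Filter.Eventually.of_forall hM)

/-- Functions of disjoint blocks of coordinates are uncorrelated under the uniform law. -/
lemma integral_cube_mul {A B : Finset (Fin d)} (hAB : Disjoint A B) {f g : (Fin d → ℝ) → ℝ}
    (hf : Measurable f) (hg : Measurable g) (hfA : DependsOn f A) (hgB : DependsOn g B) :
    ∫ v, f v * g v ∂cube d = (∫ v, f v ∂cube d) * ∫ v, g v ∂cube d := by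
  have hind : iIndepFun (fun (i : Fin d) (v : Fin d → ℝ) => v i) (cube d) :=
    iIndepFun_pi (X := fun _ : Fin d => (id : ℝ → ℝ)) fun _ => aemeasurable_id
  have h := (hind.indepFun_finset A B hAB measurable_pi_apply).comp
    (hf.comp (measurable_extendZero (· ∈ A))) (hg.comp (measurable_extendZero (· ∈ B)))
  have hfe : ((f ∘ extendZero (· ∈ A)) ∘ fun (v : Fin d → ℝ) (i : A) => v i) = f := by
    ext v
    exact hfA fun k hk => extendZero_apply (· ∈ A) _ hk
  have hge : ((g ∘ extendZero (· ∈ B)) ∘ fun (v : Fin d → ℝ) (i : B) => v i) = g := by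
    ext v
    exact hgB fun k hk => extendZero_apply (· ∈ B) _ hk
  rw [hfe, hge] at h
  exact h.integral_fun_mul_eq_mul_integral hf.aestronglyMeasurable hg.aestronglyMeasurable

/-- Peel off one block at a time: the remaining product depends on the union of the remaining
blocks, which is disjoint from the one removed. -/
lemma integral_cube_prod {J : Type*} [Fintype J] {A : J → Finset (Fin d)}
    (hA : Pairwise fun j k => Disjoint (A j) (A k)) {f : J → (Fin d → ℝ) → ℝ}
    (hf : ∀ j, Measurable (f j)) (hfA : ∀ j, DependsOn (f j) (A j)) :
    ∫ v, ∏ j, f j v ∂cube d = ∏ j, ∫ v, f j v ∂cube d := by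
  classical
  induction (Finset.univ : Finset J) using Finset.induction_on with
  | empty => simp
  | insert j s hj ih =>
    simp only [Finset.prod_insert hj]
    rw [← ih]
    refine integral_cube_mul (A := A j) (B := s.biUnion A) ?_ (hf j)
      (Finset.measurable_fun_prod s fun k _ => hf k) (hfA j) ?_
    · rw [Finset.disjoint_biUnion_right]
      exact fun k hk => hA fun h => hj (h ▸ hk)
    · intro v w hvw
      refine Finset.prod_congr rfl fun k hk => hfA k fun i hi => hvw i ?_
      exact Finset.mem_coe.2 (Finset.mem_biUnion.2 ⟨k, hk, hi⟩)

/-- Chebyshev's association inequality. -/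
lemma integral_mul_integral_le_of_monotone {ρ : Measure ℝ} [IsProbabilityMeasure ρ] {f g : ℝ → ℝ}
    (hf : Monotone f) (hg : Monotone g) {M N : ℝ} (hM : ∀ x, |f x| ≤ M) (hN : ∀ x, |g x| ≤ N) :
    (∫ x, f x ∂ρ) * ∫ x, g x ∂ρ ≤ ∫ x, f x * g x ∂ρ := by
  have hfi := integrable_of_abs_le (P := ρ) hf.measurable hM
  have hgi := integrable_of_abs_le (P := ρ) hg.measurable hN
  have hfgi : Integrable (fun x => f x * g x) ρ :=
    integrable_of_abs_le (hf.measurable.mul hg.measurable) (M := M * N) fun x => by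
      rw [abs_mul]
      exact mul_le_mul (hM x) (hN x) (abs_nonneg _) ((abs_nonneg _).trans (hM x))
  -- The product `(f x - f y) * (g x - g y)` is nonnegative. Integrating over `x`, then over `y`,
  -- yields twice the claimed difference.
  have key : ∀ y, 0 ≤ (∫ x, f x * g x ∂ρ) - g y * (∫ x, f x ∂ρ) - f y * (∫ x, g x ∂ρ)
      + f y * g y := by
    intro y
    have h0 : 0 ≤ ∫ x, (f x - f y) * (g x - g y) ∂ρ := integral_nonneg fun x => by
      rcases le_total x y with h | h
      · exact mul_nonneg_of_nonpos_of_nonpos (sub_nonpos.2 (hf h)) (sub_nonpos.2 (hg h))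
      · exact mul_nonneg (sub_nonneg.2 (hf h)) (sub_nonneg.2 (hg h))
    have h1 : ∫ x, (f x - f y) * (g x - g y) ∂ρ =
        ∫ x, (f x * g x - g y * f x - f y * g x + f y * g y) ∂ρ :=
      integral_congr_ae (Filter.Eventually.of_forall fun x => by ring)
    have i1 : Integrable (fun x => f x * g x - g y * f x) ρ := hfgi.sub (hfi.const_mul _)
    have i2 : Integrable (fun x => f x * g x - g y * f x - f y * g x) ρ := i1.sub (hgi.const_mul _)
    rw [h1, integral_add i2 (integrable_const _), integral_sub i1 (hgi.const_mul _),
      integral_sub hfgi (hfi.const_mul _), integral_const_mul, integral_const_mul] at h0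
    simpa using h0
  have h2 : 0 ≤ ∫ y, ((∫ x, f x * g x ∂ρ) - g y * (∫ x, f x ∂ρ) - f y * (∫ x, g x ∂ρ)
      + f y * g y) ∂ρ := integral_nonneg key
  have i1 : Integrable (fun y => (∫ x, f x * g x ∂ρ) - g y * (∫ x, f x ∂ρ)) ρ :=
    (integrable_const _).sub (hgi.mul_const _)
  have i2 : Integrable (fun y => (∫ x, f x * g x ∂ρ) - g y * (∫ x, f x ∂ρ)
      - f y * (∫ x, g x ∂ρ)) ρ := i1.sub (hfi.mul_const _)
  rw [integral_add i2 hfgi, integral_sub i1 (hfi.mul_const _),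
    integral_sub (integrable_const _) (hgi.mul_const _), integral_mul_const,
    integral_mul_const] at h2
  simp only [integral_const, probReal_univ, one_smul] at h2
  linarith [mul_comm (∫ x, f x ∂ρ) (∫ x, g x ∂ρ)]

lemma integral_cube_succ {n : ℕ} {f : (Fin (n + 1) → ℝ) → ℝ} (hf : Measurable f) {M : ℝ}
    (hM : ∀ x, |f x| ≤ M) :
    ∫ v, f v ∂cube (n + 1) = ∫ t, ∫ y, f (Fin.cons t y) ∂cube n ∂unif := by
  have hmp := (measurePreserving_piFinSuccAbove (fun _ : Fin (n + 1) => unif) 0).symm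
  have h := hmp.integral_comp' (g := f)
  change ∫ p, f (Fin.insertNth 0 p.1 p.2) ∂(unif.prod (cube n)) = ∫ v, f v ∂cube (n + 1) at h
  rw [← h, integral_prod]
  · simp only [Fin.insertNth_zero']
  · exact integrable_of_abs_le (hf.comp hmp.measurable) fun p => hM _

lemma measurable_cons {n : ℕ} :
    Measurable fun p : ℝ × (Fin n → ℝ) => (Fin.cons p.1 p.2 : Fin (n + 1) → ℝ) := by
  refine measurable_pi_lambda _ fun k => ?_
  refine Fin.cases ?_ (fun j => ?_) k
  · simpa using measurable_fst
  · simp only [Fin.cons_succ]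
    fun_prop

/-- Harris' inequality: the uniform law on `[0,1]^n` is positively associated. -/
lemma integral_mul_integral_cube_le {n : ℕ} {f g : (Fin n → ℝ) → ℝ} (hf : Measurable f)
    (hg : Measurable g) (hfm : Monotone f) (hgm : Monotone g) {M N : ℝ} (hM : ∀ x, |f x| ≤ M)
    (hN : ∀ x, |g x| ≤ N) :
    (∫ v, f v ∂cube n) * ∫ v, g v ∂cube n ≤ ∫ v, f v * g v ∂cube n := by
  induction n with
  | zero => simp [integral_unique, cube]
  | succ n ih =>
    have hfgM : ∀ x, |f x * g x| ≤ M * N := fun x => by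
      rw [abs_mul]
      exact mul_le_mul (hM x) (hN x) (abs_nonneg _) ((abs_nonneg _).trans (hM x))
    have hfg : Measurable fun x => f x * g x := hf.mul hg
    rw [integral_cube_succ hf hM, integral_cube_succ hg hN, integral_cube_succ hfg hfgM]
    have hcons : ∀ t, Monotone fun y : Fin n → ℝ => (Fin.cons t y : Fin (n + 1) → ℝ) :=
      fun t y z h k => by
        refine Fin.cases ?_ (fun j => ?_) k
        · simp
        · simpa using h j
    have hcons' : ∀ y : Fin n → ℝ, Monotone fun t : ℝ => (Fin.cons t y : Fin (n + 1) → ℝ) :=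
      fun y s t h k => by
        refine Fin.cases ?_ (fun j => ?_) k
        · simpa using h
        · simp
    have hmeas : ∀ t, Measurable fun y : Fin n → ℝ => (Fin.cons t y : Fin (n + 1) → ℝ) :=
      fun t => measurable_cons.comp measurable_prodMk_left
    have hint : ∀ {φ : (Fin (n + 1) → ℝ) → ℝ}, Measurable φ → ∀ {K : ℝ}, (∀ x, |φ x| ≤ K) → ∀ t,
        Integrable (fun y : Fin n → ℝ => φ (Fin.cons t y)) (cube n) :=
      fun hφ K hK t => integrable_of_abs_le (hφ.comp (hmeas t)) fun y => hK _
    have hmono : ∀ {φ : (Fin (n + 1) → ℝ) → ℝ}, Measurable φ → Monotone φ → ∀ {K : ℝ},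
        (∀ x, |φ x| ≤ K) → Monotone fun t => ∫ y, φ (Fin.cons t y) ∂cube n :=
      fun hφ hφm K hK s t h => integral_mono (hint hφ hK s) (hint hφ hK t)
        fun y => hφm (hcons' y h)
    have hbd : ∀ {φ : (Fin (n + 1) → ℝ) → ℝ} {K : ℝ}, (∀ x, |φ x| ≤ K) → ∀ t,
        |∫ y, φ (Fin.cons t y) ∂cube n| ≤ K := fun {φ K} hK t => by
      simpa using norm_integral_le_of_norm_le_const (μ := cube n) (C := K)
        (f := fun y => φ (Fin.cons t y)) (Filter.Eventually.of_forall fun y => hK _)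
    -- Averages over the last `n` coordinates are increasing in the first one, so Chebyshev's
    -- inequality applies to them; the induction hypothesis then handles each slice.
    refine (integral_mul_integral_le_of_monotone (hmono hf hfm hM) (hmono hg hgm hN) (hbd hM)
      (hbd hN)).trans ?_
    refine integral_mono ?_ ?_ fun t => ?_
    · refine integrable_of_abs_le
        ((hmono hf hfm hM).measurable.mul (hmono hg hgm hN).measurable) (M := M * N) fun t => ?_
      rw [abs_mul]
      exact mul_le_mul (hbd hM t) (hbd hN t) (abs_nonneg _) ((abs_nonneg _).trans (hbd hM t))
    · exact (integrable_of_abs_le (P := unif.prod (cube n)) (hfg.comp measurable_cons)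
        fun p => hfgM _).integral_prod_left
    · exact ih (hf.comp (hmeas t)) (hg.comp (hmeas t)) (hfm.comp (hcons t)) (hgm.comp (hcons t))
        (fun y => hM _) fun y => hN _

end Cube

/-! ### Product inequalities for monotone sets -/

section Sets

variable {d : ℕ} {J : Type*} [Fintype J]

/-- The sign `s` of the difference between joint and product probabilities of the events
`x ∈ S j`, for sets `S j` of kind `K` which depend on the coordinates in `A j` only. -/
def JointIneq (s : ℝ) (K : Set (Fin d → ℝ) → Prop) (A : J → Finset (Fin d))
    (μ : Measure (Fin d → ℝ)) : Prop :=
  ∀ S : J → Set (Fin d → ℝ), (∀ j, MeasurableSet (S j)) →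
    (∀ j, DependsOn (fun x => x ∈ S j) (A j)) → (∀ j, K (S j)) →
    s * ∏ j, μ.real (S j) ≤ s * μ.real (⋂ j, S j)

variable (μ : Measure (Fin d → ℝ)) [IsProbabilityMeasure μ]

/-- The quantile map is increasing only on the open cube, so the plain preimage of `S` need not be
an upper set. It is corrected where a copula has no mass: points with an `A`-coordinate at least `1`
are added, other points with an `A`-coordinate at most `0` are removed. Only coordinates in `A` are
consulted, so that the block is kept. -/
lemma exists_isUpperSet_vecQuantile {A : Finset (Fin d)} {S : Set (Fin d → ℝ)}
    (hS : MeasurableSet S) (hSA : DependsOn (fun x => x ∈ S) A) (hup : IsUpperSet S) :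
    ∃ S' : Set (Fin d → ℝ), MeasurableSet S' ∧ DependsOn (fun x => x ∈ S') A ∧ IsUpperSet S' ∧
      ∀ u, (∀ i, u i ∈ Ioo (0 : ℝ) 1) → (u ∈ S' ↔ vecQuantile μ u ∈ S) := by
  refine ⟨{u | (∃ k ∈ A, 1 ≤ u k) ∨ ((∀ k ∈ A, 0 < u k) ∧ vecQuantile μ u ∈ S)}, ?_, ?_, ?_, ?_⟩
  · have h1 : MeasurableSet {u : Fin d → ℝ | ∃ k ∈ A, 1 ≤ u k} := by
      have : {u : Fin d → ℝ | ∃ k ∈ A, 1 ≤ u k} = ⋃ k ∈ A, {u | 1 ≤ u k} := by ext; simp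
      rw [this]
      exact Finset.measurableSet_biUnion _ fun k _ =>
        measurableSet_le measurable_const (measurable_pi_apply k)
    have h2 : MeasurableSet {u : Fin d → ℝ | ∀ k ∈ A, 0 < u k} := by
      have : {u : Fin d → ℝ | ∀ k ∈ A, 0 < u k} = ⋂ k ∈ A, {u | 0 < u k} := by ext; simp
      rw [this]
      exact Finset.measurableSet_biInter _ fun k _ =>
        measurableSet_lt measurable_const (measurable_pi_apply k)
    exact h1.union (h2.inter (measurable_vecQuantile μ hS))
  · intro u w huw
    refine propext (or_congr (exists_congr fun k => and_congr_right fun hk => ?_)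
      (and_congr (forall₂_congr fun k hk => ?_) (iff_of_eq (hSA fun k hk => ?_))))
    · rw [huw k hk]
    · rw [huw k hk]
    · simp only [vecQuantile, huw k hk]
  · rintro u w huw (⟨k, hk, h⟩ | ⟨h0, hu⟩)
    · exact Or.inl ⟨k, hk, h.trans (huw k)⟩
    by_cases hw : ∃ k ∈ A, 1 ≤ w k
    · exact Or.inl hw
    push Not at hw
    refine Or.inr ⟨fun k hk => (h0 k hk).trans_le (huw k), ?_⟩
    have hle : ∀ k ∈ A, vecQuantile μ u k ≤ vecQuantile μ w k := fun k hk =>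
      quantile_monotoneOn _ ⟨h0 k hk, (huw k).trans_lt (hw k hk)⟩
        ⟨(h0 k hk).trans_le (huw k), hw k hk⟩ (huw k)
    -- Off `A` the quantiles of `u` and `w` need not be ordered. Their supremum dominates the former
    -- and agrees with the latter on `A`, which is all that `S` sees.
    have hz : (vecQuantile μ u ⊔ vecQuantile μ w) ∈ S := hup le_sup_left hu
    refine (hSA (x := vecQuantile μ u ⊔ vecQuantile μ w) (y := vecQuantile μ w)
      fun k hk => ?_).mp hz
    exact sup_eq_right.2 (hle k hk)
  · intro u hu
    constructor
    · rintro (⟨k, -, h⟩ | ⟨-, h⟩)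
      · exact absurd h (not_le.2 (hu k).2)
      · exact h
    · exact fun h => Or.inr ⟨fun k _ => (hu k).1, h⟩

lemma exists_isLowerSet_vecQuantile {A : Finset (Fin d)} {S : Set (Fin d → ℝ)}
    (hS : MeasurableSet S) (hSA : DependsOn (fun x => x ∈ S) A) (hlow : IsLowerSet S) :
    ∃ S' : Set (Fin d → ℝ), MeasurableSet S' ∧ DependsOn (fun x => x ∈ S') A ∧ IsLowerSet S' ∧
      ∀ u, (∀ i, u i ∈ Ioo (0 : ℝ) 1) → (u ∈ S' ↔ vecQuantile μ u ∈ S) := by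
  obtain ⟨S', h1, h2, h3, h4⟩ := exists_isUpperSet_vecQuantile μ (A := A) hS.compl
    (fun x y h => congrArg Not (hSA h)) hlow.compl
  refine ⟨S'ᶜ, h1.compl, fun x y h => congrArg Not (h2 h), h3.compl, fun u hu => ?_⟩
  rw [mem_compl_iff, h4 u hu, mem_compl_iff, not_not]

variable {μ} {s : ℝ} {A : J → Finset (Fin d)}

/-- Product inequalities pass from a copula of `μ` to `μ`. -/
lemma JointIneq.of_copula {K : Set (Fin d → ℝ) → Prop} (hK : K = IsUpperSet ∨ K = IsLowerSet)
    {C : Measure (Fin d → ℝ)} (hC : IsCopula C) (hmap : C.map (vecQuantile μ) = μ)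
    (h : JointIneq s K A C) : JointIneq s K A μ := by
  intro S hS hSA hSK
  have hex : ∀ j, ∃ S' : Set (Fin d → ℝ), MeasurableSet S' ∧ DependsOn (fun x => x ∈ S') (A j) ∧
      K S' ∧ ∀ u, (∀ i, u i ∈ Ioo (0 : ℝ) 1) → (u ∈ S' ↔ vecQuantile μ u ∈ S j) := by
    intro j
    rcases hK with rfl | rfl
    · exact exists_isUpperSet_vecQuantile μ (hS j) (hSA j) (hSK j)
    · exact exists_isLowerSet_vecQuantile μ (hS j) (hSA j) (hSK j)
  choose S' h1 h2 h3 h4 using hex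
  have e1 : ∀ j, μ.real (S j) = C.real (S' j) := fun j => by
    conv_lhs => rw [← hmap, map_measureReal_apply (measurable_vecQuantile μ) (hS j)]
    refine measureReal_congr ?_
    filter_upwards [hC.ae_mem_Ioo] with u hu
    exact propext (h4 j u hu).symm
  have e2 : μ.real (⋂ j, S j) = C.real (⋂ j, S' j) := by
    conv_lhs => rw [← hmap, map_measureReal_apply (measurable_vecQuantile μ)
      (MeasurableSet.iInter hS)]
    refine measureReal_congr ?_
    filter_upwards [hC.ae_mem_Ioo] with u hu
    refine propext ?_
    change vecQuantile μ u ∈ ⋂ j, S j ↔ u ∈ ⋂ j, S' j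
    simp only [mem_iInter, h4 _ u hu]
  simp only [e1, e2]
  exact h S' h1 h2 h3

variable (μ) in
/-- The probability that the distributional transform with parameters `v` falls into `S`. -/
noncomputable def sliceProb (S : Set (Fin d → ℝ)) (v : Fin d → ℝ) : ℝ :=
  μ.real {x | vecTransform μ x v ∈ S}

lemma measurable_sliceProb {S : Set (Fin d → ℝ)} (hS : MeasurableSet S) :
    Measurable (sliceProb μ S) :=
  (measurable_measure_prodMk_right (μ := μ) (measurable_vecTransform μ hS)).ennreal_toReal

lemma abs_sliceProb_le (S : Set (Fin d → ℝ)) (v : Fin d → ℝ) : |sliceProb μ S v| ≤ 1 := by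
  rw [sliceProb, abs_of_nonneg measureReal_nonneg]
  exact measureReal_le_one

lemma lawCheckerboard_real {S : Set (Fin d → ℝ)} (hS : MeasurableSet S) :
    (lawCheckerboard μ).real S = ∫ v, sliceProb μ S v ∂cube d := by
  have hm := measurable_vecTransform μ hS
  rw [lawCheckerboard, map_measureReal_apply (measurable_vecTransform μ) hS, measureReal_def,
    Measure.prod_apply_symm hm, ← integral_toReal (measurable_measure_prodMk_right hm).aemeasurable
    (Filter.Eventually.of_forall fun _ => measure_lt_top _ _)]
  rfl

omit [IsProbabilityMeasure μ] in
lemma dependsOn_sliceProb {S : Set (Fin d → ℝ)} {A : Finset (Fin d)}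
    (hSA : DependsOn (fun x => x ∈ S) A) : DependsOn (sliceProb μ S) A := by
  intro v w h
  unfold sliceProb
  congr 1
  ext x
  refine iff_of_eq (hSA fun k hk => ?_)
  simp only [vecTransform, h k hk]

/-- For fixed `v` in the cube, `x ↦ T(x, v)` is increasing and acts coordinate by coordinate, so the
preimages of the `S j` are admissible for `μ`. The blocks may overlap here; only the integral on the
left is affected by that. -/
lemma JointIneq.integral_sliceProb_le {K : Set (Fin d → ℝ) → Prop}
    (hK : ∀ S, K S → ∀ φ : (Fin d → ℝ) → (Fin d → ℝ), Monotone φ → K (φ ⁻¹' S))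
    (h : JointIneq s K A μ) {S : J → Set (Fin d → ℝ)} (hS : ∀ j, MeasurableSet (S j))
    (hSA : ∀ j, DependsOn (fun x => x ∈ S j) (A j)) (hSK : ∀ j, K (S j)) :
    s * ∫ v, ∏ j, sliceProb μ (S j) v ∂cube d ≤ s * (lawCheckerboard μ).real (⋂ j, S j) := by
  rw [lawCheckerboard_real (MeasurableSet.iInter hS), ← integral_const_mul, ← integral_const_mul]
  refine integral_mono_ae (Integrable.const_mul ?_ _) (Integrable.const_mul ?_ _) ?_
  · refine integrable_of_abs_le (M := 1)
      (Finset.measurable_fun_prod _ fun j _ => measurable_sliceProb (hS j)) fun v => ?_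
    rw [Finset.abs_prod]
    exact Finset.prod_le_one (fun _ _ => abs_nonneg _) fun j _ => abs_sliceProb_le _ _
  · exact integrable_of_abs_le (measurable_sliceProb (MeasurableSet.iInter hS)) (abs_sliceProb_le _)
  · filter_upwards [ae_cube_mem_Icc] with v hv
    have := h (fun j => {x | vecTransform μ x v ∈ S j})
      (fun j => ((measurable_vecTransform μ).comp measurable_prodMk_right) (hS j))
      (fun j x y hxy => hSA j fun k hk => by simp only [vecTransform, hxy k hk])
      fun j => hK _ (hSK j) _ (vecTransform_mono_left μ hv)
    have e : (⋂ j, {x | vecTransform μ x v ∈ S j}) = {x | vecTransform μ x v ∈ ⋂ j, S j} := by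
      ext; simp
    rw [e] at this
    exact this

/-- Product inequalities over disjoint blocks pass to the checkerboard copula. -/
lemma JointIneq.lawCheckerboard {K : Set (Fin d → ℝ) → Prop}
    (hK : ∀ S, K S → ∀ φ : (Fin d → ℝ) → (Fin d → ℝ), Monotone φ → K (φ ⁻¹' S))
    (hA : Pairwise fun j k => Disjoint (A j) (A k)) (h : JointIneq s K A μ) :
    JointIneq s K A (lawCheckerboard μ) := by
  intro S hS hSA hSK
  refine le_of_eq_of_le ?_ (h.integral_sliceProb_le hK hS hSA hSK)
  -- The slice probability of `S j` depends only on the `v k` with `k ∈ A j`, so disjointness gives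
  -- an exact factorisation, valid for either sign.
  rw [integral_cube_prod hA (fun j => measurable_sliceProb (hS j))
    fun j => dependsOn_sliceProb (hSA j)]
  simp only [lawCheckerboard_real (hS _)]

/-- Positive association of pairs of upper sets passes to the checkerboard copula. -/
lemma JointIneq.lawCheckerboard_pair {A : Fin 2 → Finset (Fin d)}
    (h : JointIneq 1 IsUpperSet A μ) :
    JointIneq 1 IsUpperSet A (CopulaDependence.lawCheckerboard μ) := by
  intro S hS hSA hSK
  refine le_trans ?_ (h.integral_sliceProb_le (fun S hS φ hφ => hS.preimage hφ) hS hSA hSK)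
  have hmono : ∀ j, Monotone (sliceProb μ (S j)) := fun j v w hvw =>
    measureReal_mono fun x hx => hSK j (vecTransform_mono_right μ x hvw) hx
  simp only [Fin.prod_univ_two, one_mul, lawCheckerboard_real (hS _)]
  -- Overlapping blocks share coordinates of `v`, but both slice probabilities increase in `v`, so
  -- Harris' inequality replaces the factorisation. Its direction fits `s = 1` only.
  exact integral_mul_integral_cube_le (measurable_sliceProb (hS 0)) (measurable_sliceProb (hS 1))
    (hmono 0) (hmono 1) (abs_sliceProb_le _) (abs_sliceProb_le _)

end Sets

/-! ### Association in terms of upper sets -/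

section Association

variable {Ω : Type*} [MeasurableSpace Ω] {P : Measure Ω} [IsProbabilityMeasure P] {s : ℝ}

lemma integral_slice_comm {Q : Type*} [MeasurableSpace Q] {ρ : Measure Q} [IsProbabilityMeasure ρ]
    {E : Set (Ω × Q)} (hE : MeasurableSet E) :
    ∫ ω, ρ.real {q | (ω, q) ∈ E} ∂P = ∫ q, P.real {ω | (ω, q) ∈ E} ∂ρ := by
  have h1 := integral_toReal (measurable_measure_prodMk_left (ν := ρ) hE).aemeasurable
    (Filter.Eventually.of_forall fun _ => measure_lt_top _ _) (μ := P)
  have h2 := integral_toReal (measurable_measure_prodMk_right (μ := P) hE).aemeasurable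
    (Filter.Eventually.of_forall fun _ => measure_lt_top _ _) (μ := ρ)
  rw [← Measure.prod_apply hE] at h1
  rw [← Measure.prod_apply_symm hE] at h2
  exact h1.trans h2.symm

/-- A number in `[0,1]` is the uniform mass of the half-line below it; exchange the integrals. -/
lemma integral_eq_integral_unif {F : Ω → ℝ} (hF : Measurable F) (hF1 : ∀ ω, F ω ∈ Icc (0 : ℝ) 1) :
    ∫ ω, F ω ∂P = ∫ a, P.real {ω | a < F ω} ∂unif := by
  have hE : MeasurableSet {p : Ω × ℝ | p.2 < F p.1} :=
    measurableSet_lt measurable_snd (hF.comp measurable_fst)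
  refine Eq.trans ?_ (integral_slice_comm (P := P) (ρ := unif) hE)
  exact integral_congr_ae (Filter.Eventually.of_forall fun ω => (unif_real_Iio (hF1 ω)).symm)

lemma integral_mul_eq_integral_unif {F G : Ω → ℝ} (hF : Measurable F) (hG : Measurable G)
    (hF1 : ∀ ω, F ω ∈ Icc (0 : ℝ) 1) (hG1 : ∀ ω, G ω ∈ Icc (0 : ℝ) 1) :
    ∫ ω, F ω * G ω ∂P =
      ∫ q, P.real {ω | q.1 < F ω ∧ q.2 < G ω} ∂(unif.prod unif) := by
  have hE : MeasurableSet {p : Ω × ℝ × ℝ | p.2.1 < F p.1 ∧ p.2.2 < G p.1} :=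
    (measurableSet_lt (measurable_fst.comp measurable_snd) (hF.comp measurable_fst)).inter
      (measurableSet_lt (measurable_snd.comp measurable_snd) (hG.comp measurable_fst))
  refine Eq.trans ?_ (integral_slice_comm (P := P) (ρ := unif.prod unif) hE)
  refine integral_congr_ae (Filter.Eventually.of_forall fun ω => ?_)
  have : {q : ℝ × ℝ | (ω, q) ∈ {p : Ω × ℝ × ℝ | p.2.1 < F p.1 ∧ p.2.2 < G p.1}} =
      Iio (F ω) ×ˢ Iio (G ω) := rfl
  simp only [this, measureReal_prod_prod, unif_real_Iio (hF1 ω), unif_real_Iio (hG1 ω)]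

lemma measurable_real_slice {Q : Type*} [MeasurableSpace Q] {E : Set (Ω × Q)}
    (hE : MeasurableSet E) : Measurable fun q => P.real {ω | (ω, q) ∈ E} :=
  (measurable_measure_prodMk_right (μ := P) hE).ennreal_toReal

/-- The product inequality for `[0,1]`-valued variables from that for their upper level sets. -/
lemma mul_integral_le_of_upperSet_unitInterval {F G : Ω → ℝ} (hF : Measurable F)
    (hG : Measurable G) (hF1 : ∀ ω, F ω ∈ Icc (0 : ℝ) 1) (hG1 : ∀ ω, G ω ∈ Icc (0 : ℝ) 1)
    (h : ∀ a b : ℝ, s * (P.real {ω | a < F ω} * P.real {ω | b < G ω}) ≤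
      s * P.real {ω | a < F ω ∧ b < G ω}) :
    s * ((∫ ω, F ω ∂P) * ∫ ω, G ω ∂P) ≤ s * ∫ ω, F ω * G ω ∂P := by
  have habs : ∀ S : Set Ω, |P.real S| ≤ 1 := fun S => by
    rw [abs_of_nonneg measureReal_nonneg]; exact measureReal_le_one
  have mF : Measurable fun a : ℝ => P.real {ω | a < F ω} :=
    measurable_real_slice (E := {p : Ω × ℝ | p.2 < F p.1})
      (measurableSet_lt measurable_snd (hF.comp measurable_fst))
  have mG : Measurable fun a : ℝ => P.real {ω | a < G ω} :=
    measurable_real_slice (E := {p : Ω × ℝ | p.2 < G p.1})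
      (measurableSet_lt measurable_snd (hG.comp measurable_fst))
  have mFG : Measurable fun q : ℝ × ℝ => P.real {ω | q.1 < F ω ∧ q.2 < G ω} :=
    measurable_real_slice (E := {p : Ω × ℝ × ℝ | p.2.1 < F p.1 ∧ p.2.2 < G p.1})
      ((measurableSet_lt (measurable_fst.comp measurable_snd) (hF.comp measurable_fst)).inter
        (measurableSet_lt (measurable_snd.comp measurable_snd) (hG.comp measurable_fst)))
  rw [integral_eq_integral_unif hF hF1, integral_eq_integral_unif hG hG1,
    integral_mul_eq_integral_unif hF hG hF1 hG1, ← integral_prod_mul, ← integral_const_mul,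
    ← integral_const_mul]
  refine integral_mono (Integrable.const_mul ?_ _) (Integrable.const_mul ?_ _) fun q => h q.1 q.2
  · refine integrable_of_abs_le ((mF.comp measurable_fst).mul (mG.comp measurable_snd)) (M := 1)
      fun q => ?_
    simp only [abs_mul]
    exact mul_le_one₀ (habs _) (abs_nonneg _) (habs _)
  · exact integrable_of_abs_le mFG fun q => habs _

/-- The truncation of `y` to `[-(n+1), n+1]`. -/
noncomputable def trunc (n : ℕ) (y : ℝ) : ℝ := max (-(n + 1 : ℝ)) (min y (n + 1))

lemma monotone_trunc (n : ℕ) : Monotone (trunc n) := fun _ _ h =>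
  max_le_max le_rfl (min_le_min h le_rfl)

lemma abs_trunc_le (n : ℕ) (y : ℝ) : |trunc n y| ≤ n + 1 := by
  have : (0 : ℝ) ≤ n := n.cast_nonneg
  rw [abs_le]
  exact ⟨le_max_left _ _, max_le (by linarith) (min_le_right _ _)⟩

lemma abs_trunc_le_abs (n : ℕ) (y : ℝ) : |trunc n y| ≤ |y| := by
  have hn : (0 : ℝ) ≤ n := n.cast_nonneg
  rw [abs_le]
  constructor
  · refine le_max_of_le_right (le_min (neg_abs_le y) ?_)
    linarith [abs_nonneg y]
  · refine max_le ?_ ((min_le_left _ _).trans (le_abs_self y))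
    linarith [abs_nonneg y]

lemma tendsto_trunc (y : ℝ) : Filter.Tendsto (fun n => trunc n y) Filter.atTop (nhds y) := by
  refine tendsto_const_nhds.congr' ?_
  obtain ⟨N, hN⟩ := exists_nat_ge |y|
  filter_upwards [Filter.eventually_ge_atTop N] with n hn
  have h : |y| ≤ n + 1 := hN.trans (by exact_mod_cast hn.trans n.le_succ)
  rw [abs_le] at h
  rw [trunc, min_eq_left h.2, max_eq_right h.1]

/-- The product inequality for general variables from that for their upper level sets. -/
lemma mul_integral_le_of_upperSet {F G : Ω → ℝ} (hF : Measurable F) (hG : Measurable G)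
    (hcov : CovExists P F G)
    (h : ∀ U V : Set ℝ, IsUpperSet U → IsUpperSet V → MeasurableSet U → MeasurableSet V →
      s * (P.real (F ⁻¹' U) * P.real (G ⁻¹' V)) ≤ s * P.real (F ⁻¹' U ∩ G ⁻¹' V)) :
    s * ((∫ ω, F ω ∂P) * ∫ ω, G ω ∂P) ≤ s * ∫ ω, F ω * G ω ∂P := by
  have hn : ∀ n : ℕ, s * ((∫ ω, trunc n (F ω) ∂P) * ∫ ω, trunc n (G ω) ∂P) ≤
      s * ∫ ω, trunc n (F ω) * trunc n (G ω) ∂P := by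
    intro n
    set N : ℝ := n + 1 with hN
    have hNpos : 0 < N := by positivity
    -- An increasing affine rescaling of the truncation to `[0,1]`. Undoing it multiplies the
    -- difference of the two sides by `4 * N ^ 2`.
    let φ : ℝ → ℝ := fun y => (trunc n y + N) / (2 * N)
    have hφm : Monotone φ := fun y z hyz =>
      div_le_div_of_nonneg_right (add_le_add_left (monotone_trunc n hyz) _) (by positivity)
    have hφ1 : ∀ y, φ y ∈ Icc (0 : ℝ) 1 := fun y => by
      have := abs_le.1 (abs_trunc_le n y)
      exact ⟨div_nonneg (by linarith) (by positivity), (div_le_one (by positivity)).2 (by linarith)⟩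
    have hφF : Measurable fun ω => φ (F ω) := hφm.measurable.comp hF
    have hφG : Measurable fun ω => φ (G ω) := hφm.measurable.comp hG
    have hup : ∀ a, IsUpperSet {y | a < φ y} := fun a y z hyz hy => lt_of_lt_of_le hy (hφm hyz)
    have hms : ∀ a, MeasurableSet {y | a < φ y} := fun a =>
      measurableSet_lt measurable_const hφm.measurable
    have key := mul_integral_le_of_upperSet_unitInterval (P := P) (s := s) hφF hφG
      (fun ω => hφ1 _) (fun ω => hφ1 _)
      fun a b => h {y | a < φ y} {y | b < φ y} (hup a) (hup b) (hms a) (hms b)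
    have hb : ∀ y, |φ y| ≤ 1 := fun y => by rw [abs_of_nonneg (hφ1 y).1]; exact (hφ1 y).2
    have iF : Integrable (fun ω => φ (F ω)) P := integrable_of_abs_le hφF fun ω => hb _
    have iG : Integrable (fun ω => φ (G ω)) P := integrable_of_abs_le hφG fun ω => hb _
    have iFG : Integrable (fun ω => φ (F ω) * φ (G ω)) P :=
      integrable_of_abs_le (hφF.mul hφG) (M := 1) fun ω => by
        rw [abs_mul]; exact mul_le_one₀ (hb _) (abs_nonneg _) (hb _)
    have htr : ∀ y, trunc n y = 2 * N * φ y - N := fun y => by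
      simp only [φ]; field_simp; ring
    have eI : ∀ H : Ω → ℝ, Integrable (fun ω => φ (H ω)) P →
        ∫ ω, trunc n (H ω) ∂P = 2 * N * (∫ ω, φ (H ω) ∂P) - N := fun H iH => by
      simp only [htr]
      rw [integral_sub (iH.const_mul _) (integrable_const _), integral_const_mul]
      simp
    have e3 : ∫ ω, trunc n (F ω) * trunc n (G ω) ∂P = 4 * N ^ 2 * (∫ ω, φ (F ω) * φ (G ω) ∂P)
        - 2 * N ^ 2 * (∫ ω, φ (F ω) ∂P) - 2 * N ^ 2 * (∫ ω, φ (G ω) ∂P) + N ^ 2 := by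
      have e : ∀ ω, trunc n (F ω) * trunc n (G ω) = 4 * N ^ 2 * (φ (F ω) * φ (G ω))
          - 2 * N ^ 2 * φ (F ω) - 2 * N ^ 2 * φ (G ω) + N ^ 2 := fun ω => by
        rw [htr, htr]; ring
      have i1 : Integrable (fun ω => 4 * N ^ 2 * (φ (F ω) * φ (G ω)) - 2 * N ^ 2 * φ (F ω)) P :=
        (iFG.const_mul _).sub (iF.const_mul _)
      have i2 : Integrable (fun ω => 4 * N ^ 2 * (φ (F ω) * φ (G ω)) - 2 * N ^ 2 * φ (F ω)
          - 2 * N ^ 2 * φ (G ω)) P := i1.sub (iG.const_mul _)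
      simp only [e]
      rw [integral_add i2 (integrable_const _), integral_sub i1 (iG.const_mul _),
        integral_sub (iFG.const_mul _) (iF.const_mul _), integral_const_mul, integral_const_mul,
        integral_const_mul]
      simp
    rw [eI F iF, eI G iG, e3]
    have := mul_le_mul_of_nonneg_left key (by positivity : (0 : ℝ) ≤ 4 * N ^ 2)
    linarith
  have hmt := fun n => (monotone_trunc n).measurable
  have lim : ∀ H : Ω → ℝ, Measurable H → Integrable H P →
      Filter.Tendsto (fun n : ℕ => ∫ ω, trunc n (H ω) ∂P) Filter.atTop (nhds (∫ ω, H ω ∂P)) :=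
    fun H hH iH => tendsto_integral_of_dominated_convergence (fun ω => |H ω|)
      (fun n => ((hmt n).comp hH).aestronglyMeasurable) iH.abs
      (fun n => Filter.Eventually.of_forall fun ω => abs_trunc_le_abs n _)
      (Filter.Eventually.of_forall fun ω => tendsto_trunc _)
  -- Truncation decreases each absolute value, so `|F G|` dominates and no second moments are
  -- needed.
  have lim2 : Filter.Tendsto (fun n : ℕ => ∫ ω, trunc n (F ω) * trunc n (G ω) ∂P) Filter.atTop
      (nhds (∫ ω, F ω * G ω ∂P)) :=
    tendsto_integral_of_dominated_convergence (fun ω => |F ω * G ω|)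
      (fun n => (((hmt n).comp hF).mul ((hmt n).comp hG)).aestronglyMeasurable) hcov.2.2.abs
      (fun n => Filter.Eventually.of_forall fun ω => by
        rw [Real.norm_eq_abs, abs_mul, abs_mul]
        exact mul_le_mul (abs_trunc_le_abs n _) (abs_trunc_le_abs n _) (abs_nonneg _)
          (abs_nonneg _))
      (Filter.Eventually.of_forall fun ω => (tendsto_trunc _).mul (tendsto_trunc _))
  exact le_of_tendsto_of_tendsto'
    (((lim F hF hcov.1).mul (lim G hG hcov.2.1)).const_mul s) (lim2.const_mul s) hn

lemma CovExists.covariance_eq {F G : Ω → ℝ} (h : CovExists P F G) :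
    covariance F G P = (∫ ω, F ω * G ω ∂P) - (∫ ω, F ω ∂P) * ∫ ω, G ω ∂P := by
  obtain ⟨hF, hG, hFG⟩ := h
  rw [covariance]
  have e : ∀ ω, (F ω - ∫ ω, F ω ∂P) * (G ω - ∫ ω, G ω ∂P) = F ω * G ω - (∫ ω, G ω ∂P) * F ω
      - (∫ ω, F ω ∂P) * G ω + (∫ ω, F ω ∂P) * ∫ ω, G ω ∂P := fun ω => by ring
  have i1 : Integrable (fun ω => F ω * G ω - (∫ ω, G ω ∂P) * F ω) P := hFG.sub (hF.const_mul _)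
  have i2 : Integrable (fun ω => F ω * G ω - (∫ ω, G ω ∂P) * F ω - (∫ ω, F ω ∂P) * G ω) P :=
    i1.sub (hG.const_mul _)
  simp only [e]
  rw [integral_add i2 (integrable_const _), integral_sub i1 (hG.const_mul _),
    integral_sub hFG (hF.const_mul _), integral_const_mul, integral_const_mul]
  simp only [integral_const, probReal_univ, one_smul]
  ring

variable {d : ℕ} {X : Ω → Fin d → ℝ}

/-- One direction tests with indicators of upper sets. In the other, upper level sets of increasing
functions of a block are upper sets depending on that block, and truncation with a layer-cake
formula recovers the covariance. A decreasing pair is reduced to an increasing one by changing both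
signs. -/
lemma covariance_iff_jointIneq (hX : Measurable X) (A B : Finset (Fin d)) :
    (∀ (f : (A → ℝ) → ℝ) (g : (B → ℝ) → ℝ), Measurable f → Measurable g → BothMonotone f g →
      CovExists P (fun ω => f (sub X A ω)) (fun ω => g (sub X B ω)) →
      0 ≤ s * covariance (fun ω => f (sub X A ω)) (fun ω => g (sub X B ω)) P) ↔
    JointIneq s IsUpperSet ![A, B] (P.map X) := by
  have hsub : ∀ A : Finset (Fin d), Measurable (sub X A) := fun A =>
    measurable_pi_lambda _ fun k => (measurable_pi_apply _).comp hX
  constructor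
  · intro h S hS hSA hSK
    have hA : DependsOn (fun x => x ∈ S 0) A := hSA 0
    have hB : DependsOn (fun x => x ∈ S 1) B := hSA 1
    have key : ∀ (A : Finset (Fin d)) (S : Set (Fin d → ℝ)), MeasurableSet S →
        DependsOn (fun x => x ∈ S) A → IsUpperSet S →
        ∃ f : (A → ℝ) → ℝ, Measurable f ∧ Monotone f ∧
          (fun ω => f (sub X A ω)) = (X ⁻¹' S).indicator fun _ => (1 : ℝ) := by
      intro A S hS hSA hSK
      -- The filling value `0` is irrelevant, since membership in `S` ignores the coordinates
      -- outside `A`.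
      refine ⟨(extendZero (· ∈ A) ⁻¹' S).indicator fun _ => (1 : ℝ),
        measurable_const.indicator (measurable_extendZero _ hS), fun z w hzw => ?_, ?_⟩
      · by_cases hz : z ∈ extendZero (· ∈ A) ⁻¹' S
        · have hw : w ∈ extendZero (· ∈ A) ⁻¹' S := hSK (monotone_extendZero _ hzw) hz
          rw [indicator_of_mem hz, indicator_of_mem hw]
        · rw [indicator_of_notMem hz]
          exact indicator_nonneg (fun _ _ => zero_le_one) _
      · ext ω
        have : sub X A ω ∈ extendZero (· ∈ A) ⁻¹' S ↔ ω ∈ X ⁻¹' S :=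
          iff_of_eq (hSA fun k hk => extendZero_apply (· ∈ A) _ hk)
        by_cases hω : ω ∈ X ⁻¹' S
        · rw [indicator_of_mem hω, indicator_of_mem (this.2 hω)]
        · rw [indicator_of_notMem hω, indicator_of_notMem (fun h' => hω (this.1 h'))]
    obtain ⟨f, hf, hfm, hfe⟩ := key A (S 0) (hS 0) hA (hSK 0)
    obtain ⟨g, hg, hgm, hge⟩ := key B (S 1) (hS 1) hB (hSK 1)
    have hmul : (fun ω => (X ⁻¹' S 0).indicator (fun _ => (1 : ℝ)) ω *
        (X ⁻¹' S 1).indicator (fun _ => (1 : ℝ)) ω) =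
        (X ⁻¹' ⋂ j, S j).indicator fun _ => (1 : ℝ) := by
      have : X ⁻¹' (⋂ j, S j) = X ⁻¹' S 0 ∩ X ⁻¹' S 1 := by
        ext ω
        simp [Fin.forall_fin_two]
      ext ω
      rw [this]
      by_cases h0 : ω ∈ X ⁻¹' S 0 <;> by_cases h1 : ω ∈ X ⁻¹' S 1 <;>
        simp only [indicator, mem_inter_iff, h0, h1, if_true, if_false, and_self, and_false,
          false_and, mul_one, mul_zero]
    have hi : ∀ T, MeasurableSet T → Integrable ((X ⁻¹' T).indicator fun _ => (1 : ℝ)) P :=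
      fun T hT => (integrable_const _).indicator (hX hT)
    have hcov : CovExists P (fun ω => f (sub X A ω)) (fun ω => g (sub X B ω)) := by
      rw [hfe, hge]
      refine ⟨hi _ (hS 0), hi _ (hS 1), ?_⟩
      rw [hmul]
      exact hi _ (MeasurableSet.iInter hS)
    have hI : ∀ T, MeasurableSet T →
        ∫ ω, (X ⁻¹' T).indicator (fun _ => (1 : ℝ)) ω ∂P = (P.map X).real T := fun T hT => by
      rw [map_measureReal_apply hX hT]
      exact integral_indicator_one (hX hT)
    have := h f g hf hg (Or.inl ⟨hfm, hgm⟩) hcov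
    rw [hfe, hge] at hcov this
    rw [hcov.covariance_eq, hmul, hI _ (hS 0), hI _ (hS 1),
      hI _ (MeasurableSet.iInter hS)] at this
    rw [Fin.prod_univ_two]
    linarith
  · intro h
    have main : ∀ (f : (A → ℝ) → ℝ) (g : (B → ℝ) → ℝ), Measurable f → Measurable g →
        Monotone f → Monotone g →
        CovExists P (fun ω => f (sub X A ω)) (fun ω => g (sub X B ω)) →
        0 ≤ s * covariance (fun ω => f (sub X A ω)) (fun ω => g (sub X B ω)) P := by
      intro f g hf hg hfm hgm hcov
      rw [hcov.covariance_eq, mul_sub, sub_nonneg]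
      refine mul_integral_le_of_upperSet (hf.comp (hsub A)) (hg.comp (hsub B)) hcov ?_
      intro U V hU hV hUm hVm
      have hres : ∀ A : Finset (Fin d), Measurable fun (x : Fin d → ℝ) (k : A) => x k :=
        fun A => measurable_pi_lambda _ fun k => measurable_pi_apply _
      let S : Fin 2 → Set (Fin d → ℝ) :=
        ![{x | f (fun k => x k) ∈ U}, {x | g (fun k => x k) ∈ V}]
      have hS : ∀ j, MeasurableSet (S j) := Fin.forall_fin_two.2
        ⟨hf.comp (hres A) hUm, hg.comp (hres B) hVm⟩
      have := h S hS (Fin.forall_fin_two.2 ⟨?_, ?_⟩) (Fin.forall_fin_two.2 ⟨?_, ?_⟩)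
      · rw [Fin.prod_univ_two, map_measureReal_apply hX (hS 0), map_measureReal_apply hX (hS 1),
          map_measureReal_apply hX (MeasurableSet.iInter hS)] at this
        have e : X ⁻¹' (⋂ j, S j) = X ⁻¹' S 0 ∩ X ⁻¹' S 1 := by
          ext ω
          simp [Fin.forall_fin_two]
        rw [e] at this
        exact this
      · intro x y hxy
        have : (fun k : A => x k) = fun k : A => y k := funext fun k => hxy k k.2
        change (f (fun k => x k) ∈ U) = (f (fun k => y k) ∈ U)
        rw [this]
      · intro x y hxy
        have : (fun k : B => x k) = fun k : B => y k := funext fun k => hxy k k.2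
        change (g (fun k => x k) ∈ V) = (g (fun k => y k) ∈ V)
        rw [this]
      · exact fun x y hxy hx => hU (hfm fun k => hxy k) hx
      · exact fun x y hxy hx => hV (hgm fun k => hxy k) hx
    rintro f g hf hg (⟨hfm, hgm⟩ | ⟨hfm, hgm⟩) hcov
    · exact main f g hf hg hfm hgm hcov
    · have := main (fun z => -f z) (fun z => -g z) hf.neg hg.neg hfm.neg hgm.neg
        ⟨hcov.1.neg, hcov.2.1.neg, by simpa using hcov.2.2⟩
      rw [covariance_fun_neg_left, covariance_fun_neg_right, neg_neg] at this
      exact this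

lemma isPA_iff (hX : Measurable X) :
    IsPA P X ↔ ∀ A B : Finset (Fin d), JointIneq 1 IsUpperSet ![A, B] (P.map X) := by
  simp only [← covariance_iff_jointIneq hX, one_mul]
  rfl

lemma isNA_iff (hX : Measurable X) :
    IsNA P X ↔ ∀ A B : Finset (Fin d), Disjoint A B →
      JointIneq (-1) IsUpperSet ![A, B] (P.map X) := by
  simp only [← covariance_iff_jointIneq hX, neg_one_mul, neg_nonneg]
  rfl

end Association

/-! ### Orthant dependence and weak association in terms of monotone sets -/

section Orthant

variable {Ω : Type*} [MeasurableSpace Ω] {P : Measure Ω} [IsProbabilityMeasure P] {s : ℝ} {d : ℕ}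

/-- Every lower set of `ℝ` is a pointwise limit of half-lines `(-∞, a n]`. -/
lemma exists_seq_Iic_of_isLowerSet {L : Set ℝ} (hL : IsLowerSet L) :
    ∃ a : ℕ → ℝ, ∀ x, ∀ᶠ n in Filter.atTop, (x ≤ a n ↔ x ∈ L) := by
  rcases L.eq_empty_or_nonempty with rfl | hne
  · refine ⟨fun n => -n, fun x => ?_⟩
    obtain ⟨N, hN⟩ := exists_nat_gt (-x)
    filter_upwards [Filter.eventually_ge_atTop N] with n hn
    have : (N : ℝ) ≤ n := by exact_mod_cast hn
    simp only [mem_empty_iff_false, iff_false, not_le]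
    linarith
  by_cases hb : BddAbove L
  · by_cases hm : sSup L ∈ L
    · exact ⟨fun _ => sSup L, fun x => Filter.Eventually.of_forall fun _ =>
        ⟨fun h => hL h hm, fun h => le_csSup hb h⟩⟩
    · obtain ⟨a, -, ha, hlim⟩ := exists_seq_strictMono_tendsto (sSup L)
      refine ⟨a, fun x => ?_⟩
      by_cases hx : x ∈ L
      · have hlt : x < sSup L := lt_of_le_of_ne (le_csSup hb hx) fun h => hm (h ▸ hx)
        filter_upwards [hlim.eventually (lt_mem_nhds hlt)] with n hn
        exact iff_of_true hn.le hx
      · refine Filter.Eventually.of_forall fun n => iff_of_false (fun h => hx ?_) hx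
        obtain ⟨y, hy, hxy⟩ := exists_lt_of_lt_csSup hne (h.trans_lt (ha n))
        exact hL hxy.le hy
  · refine ⟨fun n => n, fun x => ?_⟩
    obtain ⟨N, hN⟩ := exists_nat_gt x
    filter_upwards [Filter.eventually_ge_atTop N] with n hn
    have : (N : ℝ) ≤ n := by exact_mod_cast hn
    obtain ⟨y, hy, hxy⟩ := not_bddAbove_iff.1 hb x
    exact iff_of_true (by linarith) (hL hxy.le hy)

lemma tendsto_measureReal_of_eventually_iff {E : ℕ → Set Ω} {E' : Set Ω}
    (hE : ∀ n, MeasurableSet (E n)) (h : ∀ ω, ∀ᶠ n in Filter.atTop, (ω ∈ E n ↔ ω ∈ E')) :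
    Filter.Tendsto (fun n => P.real (E n)) Filter.atTop (nhds (P.real E')) :=
  (ENNReal.tendsto_toReal (measure_ne_top _ _)).comp
    (tendsto_measure_of_tendsto_indicator Filter.atTop hE MeasurableSet.univ (measure_ne_top _ _)
      (Filter.Eventually.of_forall fun _ => subset_univ _) h)

variable {μ : Measure (Fin d → ℝ)} [IsProbabilityMeasure μ]

/-- A set depending on one coordinate can be read off on the diagonal, which encodes it as a subset
of `ℝ`. -/
lemma mem_iff_const_mem {i : Fin d} {S : Set (Fin d → ℝ)}
    (hS : DependsOn (fun x => x ∈ S) ({i} : Finset (Fin d))) (x : Fin d → ℝ) :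
    x ∈ S ↔ (fun _ => x i) ∈ S :=
  iff_of_eq (hS fun k hk => by rw [Finset.mem_singleton.1 (Finset.mem_coe.1 hk)])

/-- Here `R a t` stands for `t ≤ a` or `a < t`. Half-lines of the other type, `∅` and `ℝ` are
pointwise limits of the tested ones, and probabilities converge along such limits. -/
lemma jointIneq_singleton_of_approx {K : Set (Fin d → ℝ) → Prop} {R : ℝ → ℝ → Prop}
    (hR : ∀ a, MeasurableSet {t | R a t})
    (happ : ∀ S, K S → ∃ a : ℕ → ℝ, ∀ t, ∀ᶠ n in Filter.atTop, (R (a n) t ↔ (fun _ => t) ∈ S))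
    (h : ∀ x : Fin d → ℝ, s * ∏ i, μ.real {y | R (x i) (y i)} ≤
      s * μ.real {y | ∀ i, R (x i) (y i)}) :
    JointIneq s K (fun j : Fin d => {j}) μ := by
  intro S hS hSA hSK
  choose a ha using fun j => happ (S j) (hSK j)
  have hm : ∀ n j, MeasurableSet {y : Fin d → ℝ | R (a j n) (y j)} := fun n j =>
    measurable_pi_apply j (hR _)
  have l1 : ∀ j, Filter.Tendsto (fun n => μ.real {y | R (a j n) (y j)}) Filter.atTop
      (nhds (μ.real (S j))) := fun j =>
    tendsto_measureReal_of_eventually_iff (fun n => hm n j) fun y => by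
      filter_upwards [ha j (y j)] with n hn
      exact hn.trans (mem_iff_const_mem (hSA j) y).symm
  have l2 : Filter.Tendsto (fun n => μ.real {y | ∀ j, R (a j n) (y j)}) Filter.atTop
      (nhds (μ.real (⋂ j, S j))) := by
    refine tendsto_measureReal_of_eventually_iff (fun n => ?_) fun y => ?_
    · have : {y : Fin d → ℝ | ∀ j, R (a j n) (y j)} = ⋂ j, {y | R (a j n) (y j)} := by ext; simp
      rw [this]
      exact MeasurableSet.iInter fun j => hm n j
    · filter_upwards [Filter.eventually_all.2 fun j => ha j (y j)] with n hn
      rw [mem_iInter]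
      exact forall_congr' fun j => (hn j).trans (mem_iff_const_mem (hSA j) y).symm
  exact le_of_tendsto_of_tendsto' ((tendsto_finsetProd _ fun j _ => l1 j).const_mul s)
    (l2.const_mul s) fun n => h fun j => a j n

lemma isLowerSet_const_mem {S : Set (Fin d → ℝ)} (hS : IsLowerSet S) :
    IsLowerSet {t : ℝ | (fun _ => t) ∈ S} := fun _ _ h ht => hS (fun _ => h) ht

lemma jointIneq_singleton_lower_iff :
    (∀ x : Fin d → ℝ, s * ∏ i, μ.real {y | y i ≤ x i} ≤ s * μ.real {y | ∀ i, y i ≤ x i}) ↔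
      JointIneq s IsLowerSet (fun j : Fin d => {j}) μ := by
  refine ⟨fun h => jointIneq_singleton_of_approx (R := fun a t => t ≤ a)
    (fun a => measurableSet_Iic) (fun S hS => ?_) h, fun h x => ?_⟩
  · exact exists_seq_Iic_of_isLowerSet (isLowerSet_const_mem hS)
  · have := h (fun i => {y | y i ≤ x i}) (fun i => measurable_pi_apply i measurableSet_Iic)
      (fun i y z hyz => by simp [hyz i (by simp)]) fun i y z hzy hy => (hzy i).trans hy
    have e : (⋂ i, {y : Fin d → ℝ | y i ≤ x i}) = {y | ∀ i, y i ≤ x i} := by ext; simp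
    rwa [e] at this

lemma jointIneq_singleton_upper_iff :
    (∀ x : Fin d → ℝ, s * ∏ i, μ.real {y | x i < y i} ≤ s * μ.real {y | ∀ i, x i < y i}) ↔
      JointIneq s IsUpperSet (fun j : Fin d => {j}) μ := by
  refine ⟨fun h => jointIneq_singleton_of_approx (R := fun a t => a < t)
    (fun a => measurableSet_Ioi) (fun S hS => ?_) h, fun h x => ?_⟩
  · obtain ⟨a, ha⟩ := exists_seq_Iic_of_isLowerSet (isLowerSet_const_mem hS.compl)
    refine ⟨a, fun t => ?_⟩
    filter_upwards [ha t] with n hn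
    rw [← not_le, hn]
    exact not_not
  · have := h (fun i => {y | x i < y i}) (fun i => measurable_pi_apply i measurableSet_Ioi)
      (fun i y z hyz => by simp [hyz i (by simp)]) fun i y z hyz hy => lt_of_lt_of_le hy (hyz i)
    have e : (⋂ i, {y : Fin d → ℝ | x i < y i}) = {y | ∀ i, x i < y i} := by ext; simp
    rwa [e] at this

variable {X : Ω → Fin d → ℝ}

lemma prod_le_iff_real {ι : Type*} [Fintype ι] (E : ι → Set Ω) (E' : Set Ω) :
    ∏ i, P (E i) ≤ P E' ↔ ∏ i, P.real (E i) ≤ P.real E' := by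
  have h : (∏ i, P (E i)).toReal = ∏ i, P.real (E i) := ENNReal.toReal_prod _ _
  rw [← h, measureReal_def, ENNReal.toReal_le_toReal (ENNReal.prod_ne_top fun i _ =>
    measure_ne_top _ _) (measure_ne_top _ _)]

lemma le_prod_iff_real {ι : Type*} [Fintype ι] (E : ι → Set Ω) (E' : Set Ω) :
    P E' ≤ ∏ i, P (E i) ↔ P.real E' ≤ ∏ i, P.real (E i) := by
  have h : (∏ i, P (E i)).toReal = ∏ i, P.real (E i) := ENNReal.toReal_prod _ _
  rw [← h, measureReal_def, ENNReal.toReal_le_toReal (measure_ne_top _ _)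
    (ENNReal.prod_ne_top fun i _ => measure_ne_top _ _)]

omit [IsProbabilityMeasure P] in
lemma map_real_le (hX : Measurable X) (i : Fin d) (t : ℝ) :
    (P.map X).real {y | y i ≤ t} = P.real {ω | X ω i ≤ t} :=
  map_measureReal_apply hX (measurable_pi_apply i measurableSet_Iic)

omit [IsProbabilityMeasure P] in
lemma map_real_gt (hX : Measurable X) (i : Fin d) (t : ℝ) :
    (P.map X).real {y | t < y i} = P.real {ω | t < X ω i} :=
  map_measureReal_apply hX (measurable_pi_apply i measurableSet_Ioi)

omit [IsProbabilityMeasure P] in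
lemma map_real_forall_le (hX : Measurable X) (x : Fin d → ℝ) :
    (P.map X).real {y | ∀ i, y i ≤ x i} = P.real {ω | ∀ i, X ω i ≤ x i} :=
  map_measureReal_apply hX (measurableSet_forall_le x)

omit [IsProbabilityMeasure P] in
lemma map_real_forall_gt (hX : Measurable X) (x : Fin d → ℝ) :
    (P.map X).real {y | ∀ i, x i < y i} = P.real {ω | ∀ i, x i < X ω i} := by
  refine map_measureReal_apply hX ?_
  have : {y : Fin d → ℝ | ∀ i, x i < y i} = ⋂ i, {y | x i < y i} := by ext; simp
  rw [this]
  exact MeasurableSet.iInter fun i => measurable_pi_apply i measurableSet_Ioi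

lemma isPOD_iff (hX : Measurable X) :
    IsPOD P X ↔ JointIneq 1 IsLowerSet (fun j : Fin d => {j}) (P.map X) ∧
      JointIneq 1 IsUpperSet (fun j : Fin d => {j}) (P.map X) := by
  have := Measure.isProbabilityMeasure_map (μ := P) hX.aemeasurable
  rw [← jointIneq_singleton_lower_iff, ← jointIneq_singleton_upper_iff, IsPOD, ← forall_and]
  simp only [prod_le_iff_real, map_real_le hX, map_real_gt hX, map_real_forall_le hX,
    map_real_forall_gt hX, one_mul]

lemma isNOD_iff (hX : Measurable X) :
    IsNOD P X ↔ JointIneq (-1) IsLowerSet (fun j : Fin d => {j}) (P.map X) ∧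
      JointIneq (-1) IsUpperSet (fun j : Fin d => {j}) (P.map X) := by
  have := Measure.isProbabilityMeasure_map (μ := P) hX.aemeasurable
  rw [← jointIneq_singleton_lower_iff, ← jointIneq_singleton_upper_iff, IsNOD, ← forall_and]
  simp only [le_prod_iff_real, map_real_le hX, map_real_gt hX, map_real_forall_le hX,
    map_real_forall_gt hX, neg_one_mul, neg_le_neg_iff]

lemma measurable_omitCoord (hX : Measurable X) (i : Fin d) : Measurable (omitCoord X i) :=
  measurable_pi_lambda _ fun _ => (measurable_pi_apply _).comp hX

lemma jointIneq_compl_iff (hX : Measurable X) (i : Fin d) :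
    (∀ (S : Set ({j : Fin d // j ≠ i} → ℝ)) (x : ℝ), MeasurableSet S → IsLowerSet S →
      s * (P.real {ω | X ω i ≤ x} * P.real {ω | omitCoord X i ω ∈ S}) ≤
        s * P.real ({ω | X ω i ≤ x} ∩ {ω | omitCoord X i ω ∈ S})) ↔
      JointIneq s IsLowerSet ![{i}, {i}ᶜ] (P.map X) := by
  have hXi : Measurable fun ω => X ω i := (measurable_pi_apply i).comp hX
  constructor
  · intro h S hS hSA hSK
    have h0 : DependsOn (fun x => x ∈ S 0) ({i} : Finset (Fin d)) := hSA 0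
    have h1 : DependsOn (fun x => x ∈ S 1) (({i}ᶜ : Finset (Fin d)) : Set (Fin d)) := hSA 1
    obtain ⟨a, ha⟩ := exists_seq_Iic_of_isLowerSet (isLowerSet_const_mem (hSK 0))
    let S' : Set ({j : Fin d // j ≠ i} → ℝ) := extendZero (· ≠ i) ⁻¹' S 1
    have hS' : MeasurableSet S' := measurable_extendZero _ (hS 1)
    have hS'l : IsLowerSet S' := (hSK 1).preimage (monotone_extendZero _)
    have e1 : {ω | omitCoord X i ω ∈ S'} = X ⁻¹' S 1 := by
      ext ω
      refine iff_of_eq (h1 fun k hk => ?_)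
      have hk : k ≠ i := by simpa using hk
      exact extendZero_apply (· ≠ i) _ hk
    have e2 : X ⁻¹' (⋂ j, S j) = X ⁻¹' S 0 ∩ X ⁻¹' S 1 := by
      ext ω
      simp [Fin.forall_fin_two]
    have l1 : Filter.Tendsto (fun n => P.real {ω | X ω i ≤ a n}) Filter.atTop
        (nhds (P.real (X ⁻¹' S 0))) :=
      tendsto_measureReal_of_eventually_iff (fun n => hXi measurableSet_Iic) fun ω => by
        filter_upwards [ha (X ω i)] with n hn
        exact hn.trans (mem_iff_const_mem h0 (X ω)).symm
    have l2 : Filter.Tendsto (fun n => P.real ({ω | X ω i ≤ a n} ∩ X ⁻¹' S 1)) Filter.atTop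
        (nhds (P.real (X ⁻¹' S 0 ∩ X ⁻¹' S 1))) :=
      tendsto_measureReal_of_eventually_iff
        (fun n => (hXi measurableSet_Iic).inter (hX (hS 1))) fun ω => by
        filter_upwards [ha (X ω i)] with n hn
        exact and_congr_left fun _ => hn.trans (mem_iff_const_mem h0 (X ω)).symm
    rw [Fin.prod_univ_two, map_measureReal_apply hX (hS 0), map_measureReal_apply hX (hS 1),
      map_measureReal_apply hX (MeasurableSet.iInter hS), e2]
    refine le_of_tendsto_of_tendsto' ((l1.mul_const _).const_mul s) (l2.const_mul s) fun n => ?_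
    have := h S' (a n) hS' hS'l
    rwa [e1] at this
  · intro h S x hS hSl
    have hres : Measurable fun (y : Fin d → ℝ) (k : {j : Fin d // j ≠ i}) => y k :=
      measurable_pi_lambda _ fun k => measurable_pi_apply _
    let T : Fin 2 → Set (Fin d → ℝ) := ![{y | y i ≤ x}, {y | (fun k : {j // j ≠ i} => y k) ∈ S}]
    have hT : ∀ j, MeasurableSet (T j) := Fin.forall_fin_two.2
      ⟨measurable_pi_apply i measurableSet_Iic, hres hS⟩
    have := h T hT (Fin.forall_fin_two.2 ⟨?_, ?_⟩) (Fin.forall_fin_two.2 ⟨?_, ?_⟩)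
    · have e2 : X ⁻¹' (⋂ j, T j) = X ⁻¹' T 0 ∩ X ⁻¹' T 1 := by
        ext ω
        simp [Fin.forall_fin_two]
      rw [Fin.prod_univ_two, map_measureReal_apply hX (hT 0), map_measureReal_apply hX (hT 1),
        map_measureReal_apply hX (MeasurableSet.iInter hT), e2] at this
      exact this
    · intro y z hyz
      change (y i ≤ x) = (z i ≤ x)
      rw [hyz i (by simp)]
    · intro y z hyz
      have : (fun k : {j // j ≠ i} => y k) = fun k : {j // j ≠ i} => z k :=
        funext fun k => hyz k (by simpa using k.2)
      change ((fun k : {j // j ≠ i} => y k) ∈ S) = ((fun k : {j // j ≠ i} => z k) ∈ S)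
      rw [this]
    · exact fun y z hzy hy => (hzy i).trans hy
    · exact fun y z hzy hy => hSl (fun k => hzy k) hy

omit [IsProbabilityMeasure P] in
lemma cond_real_eq {E : Set Ω} (hE : MeasurableSet E) (S : Set Ω) :
    (ProbabilityTheory.cond P E S).toReal = (P.real E)⁻¹ * P.real (E ∩ S) := by
  rw [cond_apply hE, ENNReal.toReal_mul, ENNReal.toReal_inv]
  rfl

/-- Multiplying by `P(X_i ≤ x)` removes the conditioning; when this probability is zero, one side is
vacuous and the other trivial. -/
lemma isWPA_iff (hX : Measurable X) :
    IsWPA P X ↔ ∀ i, JointIneq 1 IsLowerSet ![{i}, {i}ᶜ] (P.map X) := by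
  simp only [← jointIneq_compl_iff hX, one_mul]
  refine forall_congr' fun i => forall₂_congr fun S x => forall₂_congr fun hS hSl => ?_
  have hE : MeasurableSet {ω | X ω i ≤ x} := (measurable_pi_apply i).comp hX measurableSet_Iic
  rcases eq_or_ne (P {ω | X ω i ≤ x}) 0 with h0 | h0
  · refine iff_of_true (fun h => absurd h0 h.ne') ?_
    rw [measureReal_def P {ω | X ω i ≤ x}, h0, ENNReal.toReal_zero, zero_mul]
    exact measureReal_nonneg
  · have hpos : 0 < P.real {ω | X ω i ≤ x} := ENNReal.toReal_pos h0 (measure_ne_top _ _)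
    have := cond_isProbabilityMeasure (μ := P) h0
    rw [← ENNReal.toReal_le_toReal (measure_ne_top _ _) (measure_ne_top _ _), cond_real_eq hE,
      le_inv_mul_iff₀ hpos]
    exact ⟨fun h => h (pos_iff_ne_zero.2 h0), fun h _ => h⟩

lemma isWNA_iff (hX : Measurable X) :
    IsWNA P X ↔ ∀ i, JointIneq (-1) IsLowerSet ![{i}, {i}ᶜ] (P.map X) := by
  simp only [← jointIneq_compl_iff hX, neg_one_mul, neg_le_neg_iff]
  refine forall_congr' fun i => forall₂_congr fun S x => forall₂_congr fun hS hSl => ?_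
  have hE : MeasurableSet {ω | X ω i ≤ x} := (measurable_pi_apply i).comp hX measurableSet_Iic
  rcases eq_or_ne (P {ω | X ω i ≤ x}) 0 with h0 | h0
  · refine iff_of_true (fun h => absurd h0 h.ne') ?_
    rw [measureReal_def P {ω | X ω i ≤ x}, h0, ENNReal.toReal_zero, zero_mul, measureReal_def,
      measure_mono_null inter_subset_left h0, ENNReal.toReal_zero]
  · have hpos : 0 < P.real {ω | X ω i ≤ x} := ENNReal.toReal_pos h0 (measure_ne_top _ _)
    have := cond_isProbabilityMeasure (μ := P) h0
    rw [← ENNReal.toReal_le_toReal (measure_ne_top _ _) (measure_ne_top _ _), cond_real_eq hE,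
      inv_mul_le_iff₀ hpos]
    exact ⟨fun h => h (pos_iff_ne_zero.2 h0), fun h _ => h⟩

end Orthant

/-! ### Monotone conditional expectations -/

section CondExp

variable {Ω : Type*} [MeasurableSpace Ω] {P : Measure Ω} [IsProbabilityMeasure P] {Y Z : Ω → ℝ}

/-- A real function which is increasing on a set `T` can be replaced by a Borel function which
is increasing on a Borel set containing `T`. -/
lemma exists_measurable_monotoneOn {h : ℝ → ℝ} {T : Set ℝ} (hT : MonotoneOn h T) :
    ∃ (h' : ℝ → ℝ) (T' : Set ℝ), Measurable h' ∧ MeasurableSet T' ∧ MonotoneOn h' T' ∧ T ⊆ T' ∧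
      EqOn h h' T := by
  -- The running supremum over `T` is monotone everywhere, hence Borel, but may be infinite off `T`;
  -- `T'` is the set where it is finite.
  let H : ℝ → EReal := fun z => ⨆ t ∈ T ∩ Iic z, (h t : EReal)
  have hH : Monotone H := fun z w hzw =>
    biSup_mono fun t ht => ⟨ht.1, ht.2.trans hzw⟩
  have hHT : ∀ z ∈ T, H z = h z := fun z hz =>
    le_antisymm (iSup₂_le fun t ht => EReal.coe_le_coe_iff.2 (hT ht.1 hz ht.2))
      (le_iSup₂_of_le z ⟨hz, self_mem_Iic⟩ le_rfl)
  refine ⟨fun z => (H z).toReal, {z | H z ≠ ⊥ ∧ H z ≠ ⊤},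
    hH.measurable.ereal_toReal, ?_, ?_, ?_, ?_⟩
  · exact (hH.measurable (measurableSet_singleton ⊥).compl).inter
      (hH.measurable (measurableSet_singleton ⊤).compl)
  · exact fun z hz w hw hzw => EReal.toReal_le_toReal (hH hzw) hz.1 hw.2
  · intro z hz
    change H z ≠ ⊥ ∧ H z ≠ ⊤
    rw [hHT z hz]
    exact ⟨EReal.coe_ne_bot _, EReal.coe_ne_top _⟩
  · intro z hz
    simp only [hHT z hz, EReal.toReal_coe]

/-- Increasing conditional expectations in terms of test functions. -/
lemma condExpIncreasing_iff (hY : Integrable Y P) (hZ : Measurable Z) :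
    CondExpIncreasing P Y Z ↔ ∃ (h : ℝ → ℝ) (T : Set ℝ), Measurable h ∧ MeasurableSet T ∧
      MonotoneOn h T ∧ (∀ᵐ ω ∂P, Z ω ∈ T) ∧ Integrable (fun ω => h (Z ω)) P ∧
      ∀ b : ℝ → ℝ, Measurable b → (∀ x, |b x| ≤ 1) →
        ∫ ω, b (Z ω) * Y ω ∂P = ∫ ω, b (Z ω) * h (Z ω) ∂P := by
  have hm : MeasurableSpace.comap Z inferInstance ≤ ‹MeasurableSpace Ω› := hZ.comap_le
  constructor
  · rintro ⟨h₀, T₀, hmono₀, hae₀, heq₀⟩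
    obtain ⟨h, T, hh, hT, hmono, hsub, heq⟩ := exists_measurable_monotoneOn hmono₀
    have hce : P[Y | MeasurableSpace.comap Z inferInstance] =ᵐ[P] fun ω => h (Z ω) := by
      filter_upwards [heq₀, hae₀] with ω h1 h2
      rw [h1, heq h2]
    refine ⟨h, T, hh, hT, hmono, hae₀.mono fun ω hω => hsub hω, integrable_condExp.congr hce,
      fun b hb hb1 => ?_⟩
    have hbZ : StronglyMeasurable[MeasurableSpace.comap Z inferInstance] fun ω => b (Z ω) :=
      (hb.comp (comap_measurable Z)).stronglyMeasurable
    have hi : Integrable ((fun ω => b (Z ω)) * Y) P :=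
      hY.bdd_mul (hb.comp hZ).aestronglyMeasurable (Filter.Eventually.of_forall fun ω => hb1 _)
    have hpull := condExp_mul_of_stronglyMeasurable_left hbZ hi hY
    calc ∫ ω, b (Z ω) * Y ω ∂P
        = ∫ ω, (P[(fun ω => b (Z ω)) * Y | MeasurableSpace.comap Z inferInstance]) ω ∂P :=
          (integral_condExp hm).symm
      _ = ∫ ω, b (Z ω) * h (Z ω) ∂P := integral_congr_ae (by
          filter_upwards [hpull, hce] with ω h1 h2
          rw [h1, Pi.mul_apply, h2])
  · rintro ⟨h, T, hh, -, hmono, hae, hint, hb⟩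
    refine ⟨h, T, hmono, hae, (ae_eq_condExp_of_forall_setIntegral_eq hm hY
      (fun _ _ _ => hint.integrableOn) ?_ ?_).symm⟩
    · rintro _ ⟨B, hB, rfl⟩ -
      have := hb (B.indicator fun _ => 1) (measurable_const.indicator hB) fun x => by
        by_cases hx : x ∈ B <;> simp [hx]
      have e : ∀ W : Ω → ℝ, ∫ ω, B.indicator (fun _ => (1 : ℝ)) (Z ω) * W ω ∂P =
          ∫ ω in Z ⁻¹' B, W ω ∂P := fun W => by
        rw [← integral_indicator (hZ hB)]
        refine integral_congr_ae (Filter.Eventually.of_forall fun ω => ?_)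
        by_cases hω : Z ω ∈ B
        · have : ω ∈ Z ⁻¹' B := hω
          simp only [indicator_of_mem hω, indicator_of_mem this, one_mul]
        · have : ω ∉ Z ⁻¹' B := hω
          simp only [indicator_of_notMem hω, indicator_of_notMem this, zero_mul]
      rw [e, e] at this
      exact this.symm
    · exact (hh.comp (comap_measurable Z)).stronglyMeasurable.aestronglyMeasurable

omit [IsProbabilityMeasure P] in
lemma CondExpIncreasing.congr {Y' : Ω → ℝ} (h : CondExpIncreasing P Y Z) (hY : Y =ᵐ[P] Y') :
    CondExpIncreasing P Y' Z := by
  obtain ⟨h₀, T, h1, h2, h3⟩ := h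
  exact ⟨h₀, T, h1, h2, (condExp_congr_ae hY).symm.trans h3⟩

omit [IsProbabilityMeasure P] in
lemma condExpDecreasing_iff_neg :
    CondExpDecreasing P Y Z ↔ CondExpIncreasing P (fun ω => -Y ω) Z := by
  have hneg := condExp_neg (μ := P) Y (MeasurableSpace.comap Z inferInstance)
  constructor
  · rintro ⟨h, T, h1, h2, h3⟩
    refine ⟨fun z => -h z, T, h1.neg, h2, hneg.trans ?_⟩
    filter_upwards [h3] with ω hω
    rw [Pi.neg_apply, hω]
  · rintro ⟨h, T, h1, h2, h3⟩
    refine ⟨fun z => -h z, T, h1.neg, h2, ?_⟩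
    filter_upwards [hneg.symm.trans h3] with ω hω
    rw [← hω, Pi.neg_apply, neg_neg]

omit [IsProbabilityMeasure P] in
lemma integral_comp_measurePreserving {Ω' : Type*} [MeasurableSpace Ω'] {P' : Measure Ω'}
    {π : Ω' → Ω} (hπ : MeasurePreserving π P' P) {W : Ω → ℝ} (hW : Measurable W) :
    ∫ ω, W (π ω) ∂P' = ∫ ω, W ω ∂P := by
  rw [← hπ.map_eq, integral_map hπ.measurable.aemeasurable hW.aestronglyMeasurable]

/-- Increasing conditional expectations only depend on the joint law. -/
lemma condExpIncreasing_comp_iff {Ω' : Type*} [MeasurableSpace Ω'] {P' : Measure Ω'}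
    [IsProbabilityMeasure P'] {π : Ω' → Ω} (hπ : MeasurePreserving π P' P) (hYm : Measurable Y)
    (hY : Integrable Y P) (hZ : Measurable Z) :
    CondExpIncreasing P' (fun ω => Y (π ω)) (fun ω => Z (π ω)) ↔ CondExpIncreasing P Y Z := by
  have hY' : Integrable (fun ω => Y (π ω)) P' := (hπ.integrable_comp hY.aestronglyMeasurable).2 hY
  have hZ' : Measurable fun ω => Z (π ω) := hZ.comp hπ.measurable
  rw [condExpIncreasing_iff hY hZ, condExpIncreasing_iff hY' hZ']
  refine exists_congr fun h => exists_congr fun T => and_congr_right fun hh =>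
    and_congr_right fun hT => and_congr_right fun _ => and_congr ?_ (and_congr ?_ ?_)
  · conv_rhs => rw [← hπ.map_eq]
    exact (ae_map_iff hπ.measurable.aemeasurable (hZ hT)).symm
  · exact hπ.integrable_comp (hh.comp hZ).aestronglyMeasurable
  · refine forall₂_congr fun b hb => forall_congr' fun _ => ?_
    rw [integral_comp_measurePreserving hπ (W := fun ω => b (Z ω) * Y ω) ((hb.comp hZ).mul hYm),
      integral_comp_measurePreserving hπ (W := fun ω => b (Z ω) * h (Z ω))
        ((hb.comp hZ).mul (hh.comp hZ))]

omit [IsProbabilityMeasure P] in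
/-- Increasing conditional expectations are preserved under dominated limits. -/
lemma CondExpIncreasing.of_tendsto {Yn : ℕ → Ω → ℝ} {bound : Ω → ℝ}
    (hYn : ∀ n, AEStronglyMeasurable (Yn n) P) (hY : Integrable Y P) (hb : Integrable bound P)
    (hle : ∀ n, ∀ᵐ ω ∂P, |Yn n ω| ≤ bound ω)
    (hlim : ∀ᵐ ω ∂P, Filter.Tendsto (fun n => Yn n ω) Filter.atTop (nhds (Y ω)))
    (h : ∀ n, CondExpIncreasing P (Yn n) Z) : CondExpIncreasing P Y Z := by
  have hint : ∀ n, Integrable (Yn n) P := fun n => hb.mono' (hYn n) (hle n)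
  have hL1 : Filter.Tendsto (fun n => eLpNorm (Yn n - Y) 1 P) Filter.atTop (nhds 0) := by
    have := tendsto_lintegral_norm_of_dominated_convergence hYn hb.hasFiniteIntegral hle hlim
    simpa only [eLpNorm_one_eq_lintegral_enorm, Pi.sub_apply, ofReal_norm] using this
  -- Conditional expectation contracts the `L¹` norm, so the conditional expectations converge in
  -- `L¹`, and almost surely along a subsequence.
  have hL1' : Filter.Tendsto (fun n => eLpNorm (P[Yn n | MeasurableSpace.comap Z inferInstance] -
      P[Y | MeasurableSpace.comap Z inferInstance]) 1 P) Filter.atTop (nhds 0) := by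
    refine tendsto_of_tendsto_of_tendsto_of_le_of_le tendsto_const_nhds hL1
      (fun _ => zero_le) fun n => ?_
    change eLpNorm _ 1 P ≤ eLpNorm _ 1 P
    rw [← eLpNorm_congr_ae (condExp_sub (hint n) hY (MeasurableSpace.comap Z inferInstance))]
    exact eLpNorm_condExp_le_eLpNorm _ le_rfl
  obtain ⟨ns, -, hns⟩ := (tendstoInMeasure_of_tendsto_eLpNorm one_ne_zero
    (fun n => integrable_condExp.aestronglyMeasurable) integrable_condExp.aestronglyMeasurable
    hL1').exists_seq_tendsto_ae
  choose hn T hmono hT heq using h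
  obtain ⟨h₀, -, hh₀⟩ := (stronglyMeasurable_condExp (μ := P) (f := Y)
    (m := MeasurableSpace.comap Z inferInstance)).measurable.exists_eq_measurable_comp
  -- On this set `h₀` is a pointwise limit of functions that are increasing there.
  refine ⟨h₀, {z | (∀ n, z ∈ T n) ∧
    Filter.Tendsto (fun k => hn (ns k) z) Filter.atTop (nhds (h₀ z))}, ?_, ?_, ?_⟩
  · exact fun z hz w hw hzw => le_of_tendsto_of_tendsto' hz.2 hw.2 fun k =>
      hmono _ (hz.1 _) (hw.1 _) hzw
  · filter_upwards [ae_all_iff.2 hT, ae_all_iff.2 heq, hns] with ω h1 h2 h3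
    refine ⟨h1, ?_⟩
    rw [hh₀] at h3
    exact h3.congr fun k => h2 (ns k)
  · rw [hh₀]
    rfl

/-- Coarsening a uniform conditioning variable by a quantile function preserves increasing
conditional expectations. -/
lemma CondExpIncreasing.comp_quantile (hY : Integrable Y P) (hZ : Measurable Z) (hU : P.map Z = unif)
    (ν : Measure ℝ) [IsProbabilityMeasure ν] (h : CondExpIncreasing P Y Z) :
    CondExpIncreasing P Y fun ω => quantile ν (Z ω) := by
  have hq := measurable_quantile ν
  have hG := measurable_distTransform ν
  obtain ⟨h, T, hh, hT, hmono, hae, hint, hb⟩ := (condExpIncreasing_iff hY hZ).1 h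
  have haeU : ∀ᵐ u ∂unif, u ∈ T := by
    rw [← hU]
    exact (ae_map_iff hZ.aemeasurable hT).2 hae
  have hintU : Integrable h unif := by
    rw [← hU]
    exact (integrable_map_measure hh.aestronglyMeasurable hZ.aemeasurable).2 hint
  have hmp : MeasurePreserving (fun p : ℝ × ℝ => distTransform ν p.1 p.2) (ν.prod unif) unif :=
    ⟨hG, map_distTransform ν⟩
  have haeG : ∀ᵐ p ∂ν.prod unif, distTransform ν p.1 p.2 ∈ T := hmp.quasiMeasurePreserving.ae haeU
  have hintG : Integrable (fun p : ℝ × ℝ => h (distTransform ν p.1 p.2)) (ν.prod unif) :=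
    (hmp.integrable_comp hh.aestronglyMeasurable).2 hintU
  have hQ : MeasurePreserving (fun ω => quantile ν (Z ω)) P ν :=
    ⟨hq.comp hZ, by
      have := Measure.map_map (μ := P) hq hZ
      rw [hU, map_quantile] at this
      exact this.symm⟩
  have hae2 : ∀ᵐ x ∂ν, (∀ᵐ v ∂unif, distTransform ν x v ∈ T) ∧
      Integrable (fun v => h (distTransform ν x v)) unif := by
    filter_upwards [Measure.ae_ae_of_ae_prod haeG, hintG.prod_right_ae] with x h1 h2
    exact ⟨h1, h2⟩
  -- Given `quantile ν (Z) = x`, the variable `Z` is distributed as the transform of `x` with a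
  -- uniform `v`. Averaging `h` over `v` therefore gives the new regression function, increasing
  -- because the transform is increasing in `x`.
  have hmono2 : MonotoneOn (fun x => ∫ v, h (distTransform ν x v) ∂unif)
      {x | (∀ᵐ v ∂unif, distTransform ν x v ∈ T) ∧
        Integrable (fun v => h (distTransform ν x v)) unif} := by
    intro x hx y hy hxy
    refine integral_mono_ae hx.2 hy.2 ?_
    filter_upwards [hx.1, hy.1, ae_unif_mem_Icc] with v h1 h2 h3
    exact hmono h1 h2 (distTransform_mono_left ν h3 hxy)
  obtain ⟨k, T', hkm, hT', hkmono, hsub, hkeq⟩ := exists_measurable_monotoneOn hmono2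
  have hkae : (fun x => ∫ v, h (distTransform ν x v) ∂unif) =ᵐ[ν] k :=
    hae2.mono fun x hx => hkeq hx
  have hkint : Integrable k ν := hintG.integral_prod_left.congr hkae
  refine (condExpIncreasing_iff hY (hq.comp hZ)).2 ⟨k, T', hkm, hT', hkmono, ?_, ?_, ?_⟩
  · exact hQ.quasiMeasurePreserving.ae (hae2.mono fun x hx => hsub hx)
  · exact (hQ.integrable_comp hkm.aestronglyMeasurable).2 hkint
  · intro b hbm hb1
    have hbint : Integrable (fun p : ℝ × ℝ => b p.1 * h (distTransform ν p.1 p.2))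
        (ν.prod unif) := hintG.bdd_mul (hbm.comp measurable_fst).aestronglyMeasurable
          (Filter.Eventually.of_forall fun p => hb1 _)
    calc ∫ ω, b (quantile ν (Z ω)) * Y ω ∂P
        = ∫ ω, b (quantile ν (Z ω)) * h (Z ω) ∂P :=
          hb (fun u => b (quantile ν u)) (hbm.comp hq) fun x => hb1 _
      _ = ∫ u, b (quantile ν u) * h u ∂unif := by
          exact integral_comp_measurePreserving (⟨hZ, hU⟩ : MeasurePreserving Z P unif)
            (W := fun u => b (quantile ν u) * h u) ((hbm.comp hq).mul hh)
      _ = ∫ p, b (quantile ν (distTransform ν p.1 p.2)) *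
            h (distTransform ν p.1 p.2) ∂(ν.prod unif) := by
          exact (integral_comp_measurePreserving hmp
            (W := fun u => b (quantile ν u) * h u) ((hbm.comp hq).mul hh)).symm
      _ = ∫ p, b p.1 * h (distTransform ν p.1 p.2) ∂(ν.prod unif) := integral_congr_ae (by
          filter_upwards [ae_quantile_distTransform ν] with p hp
          rw [hp])
      _ = ∫ x, b x * k x ∂ν := by
          rw [integral_prod _ hbint]
          refine integral_congr_ae ?_
          filter_upwards [hkae] with x hx
          rw [← hx, integral_const_mul]
      _ = ∫ ω, b (quantile ν (Z ω)) *
            k (quantile ν (Z ω)) ∂P := by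
          exact (integral_comp_measurePreserving hQ (W := fun x => b x * k x)
            (hbm.mul hkm)).symm

end CondExp

/-! ### Regression dependence -/

section Regression

variable {Ω : Type*} [MeasurableSpace Ω] {P : Measure Ω} [IsProbabilityMeasure P] {s : ℝ} {d : ℕ}
  {X : Ω → Fin d → ℝ}

/-- Regression dependence with sign `s`, tested on bounded functions. -/
def BoundedRD (s : ℝ) (P : Measure Ω) (X : Ω → Fin d → ℝ) : Prop :=
  ∀ (i : Fin d) (g : ({j : Fin d // j ≠ i} → ℝ) → ℝ) (M : ℝ),
    Measurable g → Monotone g → (∀ z, |g z| ≤ M) →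
    CondExpIncreasing P (fun ω => s * g (omitCoord X i ω)) (fun ω => X ω i)

/-- Truncations of an increasing `g` are bounded and increasing, and the property survives dominated
limits. -/
lemma boundedRD_iff (hX : Measurable X) :
    BoundedRD s P X ↔ ∀ (i : Fin d) (g : ({j : Fin d // j ≠ i} → ℝ) → ℝ),
      Measurable g → Monotone g → Integrable (fun ω => g (omitCoord X i ω)) P →
      CondExpIncreasing P (fun ω => s * g (omitCoord X i ω)) (fun ω => X ω i) := by
  constructor
  · intro h i g hg hgm hint
    have hgX : Measurable fun ω => g (omitCoord X i ω) := hg.comp (measurable_omitCoord hX i)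
    refine CondExpIncreasing.of_tendsto (Yn := fun n ω => s * trunc n (g (omitCoord X i ω)))
      (bound := fun ω => |s * g (omitCoord X i ω)|) (fun n => ?_) (hint.const_mul s)
      (hint.const_mul s).abs (fun n => Filter.Eventually.of_forall fun ω => ?_)
      (Filter.Eventually.of_forall fun ω => (tendsto_trunc _).const_mul s) fun n => ?_
    · exact (((monotone_trunc n).measurable.comp hgX).const_mul s).aestronglyMeasurable
    · rw [abs_mul, abs_mul]
      exact mul_le_mul_of_nonneg_left (abs_trunc_le_abs n _) (abs_nonneg s)
    · exact h i (fun z => trunc n (g z)) (n + 1) ((monotone_trunc n).measurable.comp hg)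
        ((monotone_trunc n).comp hgm) fun z => abs_trunc_le n _
  · exact fun h i g M hg hgm hM => h i g hg hgm
      (integrable_of_abs_le (hg.comp (measurable_omitCoord hX i)) fun ω => hM _)

lemma isPRD_iff (hX : Measurable X) : IsPRD P X ↔ BoundedRD 1 P X := by
  rw [boundedRD_iff hX]
  simp only [one_mul]
  rfl

lemma isNRD_iff (hX : Measurable X) : IsNRD P X ↔ BoundedRD (-1) P X := by
  rw [boundedRD_iff hX]
  simp only [neg_one_mul, ← condExpDecreasing_iff_neg]
  rfl

/-- Regression dependence only depends on the law. -/
lemma boundedRD_iff_of_measurePreserving {Ω' : Type*} [MeasurableSpace Ω'] {P' : Measure Ω'}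
    [IsProbabilityMeasure P'] {π : Ω' → Ω} (hπ : MeasurePreserving π P' P) (hX : Measurable X) :
    BoundedRD s P' (fun ω => X (π ω)) ↔ BoundedRD s P X := by
  refine forall₃_congr fun i g M => forall₃_congr fun hg _ hM => ?_
  have hgX : Measurable fun ω => g (omitCoord X i ω) := hg.comp (measurable_omitCoord hX i)
  exact condExpIncreasing_comp_iff (Y := fun ω => s * g (omitCoord X i ω))
    (Z := fun ω => X ω i) hπ (hgX.const_mul s)
    ((integrable_of_abs_le hgX fun ω => hM _).const_mul s) ((measurable_pi_apply i).comp hX)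

/-- A bounded increasing function of coordinatewise quantiles extends from the open unit cube to
an increasing function on the whole space. -/
lemma exists_monotone_extension {ι : Type*} [Finite ι] {q : ι → ℝ → ℝ}
    (hq : ∀ k, MonotoneOn (q k) (Ioo 0 1)) (hqm : ∀ k, Measurable (q k)) {g : (ι → ℝ) → ℝ}
    (hg : Measurable g) (hgm : Monotone g) {M : ℝ} (hM : ∀ z, |g z| ≤ M) :
    ∃ g' : (ι → ℝ) → ℝ, Measurable g' ∧ Monotone g' ∧ (∀ z, |g' z| ≤ M) ∧
      ∀ u, (∀ k, u k ∈ Ioo (0 : ℝ) 1) → g' u = g fun k => q k (u k) := by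
  classical
  have hMg : ∀ z, -M ≤ g z ∧ g z ≤ M := fun z => abs_le.1 (hM z)
  have hM0 : 0 ≤ M := (abs_nonneg _).trans (hM 0)
  -- Boundedness supplies the constants `M` and `-M`, above and below all values of `g`, to use off
  -- the open cube.
  refine ⟨fun u => if ∃ k, 1 ≤ u k then M else if ∃ k, u k ≤ 0 then -M else
    g fun k => q k (u k), ?_, ?_, ?_, ?_⟩
  · have h1 : MeasurableSet {u : ι → ℝ | ∃ k, 1 ≤ u k} := by
      have : {u : ι → ℝ | ∃ k, 1 ≤ u k} = ⋃ k, {u | 1 ≤ u k} := by ext; simp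
      rw [this]
      exact MeasurableSet.iUnion fun k => measurableSet_le measurable_const (measurable_pi_apply k)
    have h2 : MeasurableSet {u : ι → ℝ | ∃ k, u k ≤ 0} := by
      have : {u : ι → ℝ | ∃ k, u k ≤ 0} = ⋃ k, {u | u k ≤ 0} := by ext; simp
      rw [this]
      exact MeasurableSet.iUnion fun k => measurableSet_le (measurable_pi_apply k) measurable_const
    exact Measurable.ite h1 measurable_const (Measurable.ite h2 measurable_const (hg.comp
      (measurable_pi_lambda _ fun k => (hqm k).comp (measurable_pi_apply k))))
  · intro u w huw
    have hle : ∀ u : ι → ℝ, (if ∃ k, 1 ≤ u k then M else if ∃ k, u k ≤ 0 then -M else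
        g fun k => q k (u k)) ≤ M := fun u => by
      split_ifs
      · exact le_rfl
      · linarith
      · exact (hMg _).2
    by_cases hw : ∃ k, 1 ≤ w k
    · simp only [if_pos hw]
      exact hle u
    have hu : ¬ ∃ k, 1 ≤ u k := fun ⟨k, hk⟩ => hw ⟨k, hk.trans (huw k)⟩
    simp only [if_neg hw, if_neg hu]
    by_cases hu0 : ∃ k, u k ≤ 0
    · simp only [if_pos hu0]
      split_ifs
      · exact le_rfl
      · exact (hMg _).1
    have hw0 : ¬ ∃ k, w k ≤ 0 := fun ⟨k, hk⟩ => hu0 ⟨k, (huw k).trans hk⟩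
    simp only [if_neg hu0, if_neg hw0]
    push Not at hw hu hu0 hw0
    exact hgm fun k => hq k ⟨hu0 k, hu k⟩ ⟨hw0 k, hw k⟩ (huw k)
  · intro u
    simp only
    split_ifs
    · exact (abs_of_nonneg hM0).le
    · rw [abs_neg, abs_of_nonneg hM0]
    · exact hM _
  · intro u hu
    have h1 : ¬ ∃ k, 1 ≤ u k := fun ⟨k, hk⟩ => absurd hk (not_le.2 (hu k).2)
    have h2 : ¬ ∃ k, u k ≤ 0 := fun ⟨k, hk⟩ => absurd hk (not_le.2 (hu k).1)
    simp only [if_neg h1, if_neg h2]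

variable {μ : Measure (Fin d → ℝ)} [IsProbabilityMeasure μ]

/-- Regression dependence passes from a copula of `μ` to `μ`. -/
lemma BoundedRD.of_copula {C : Measure (Fin d → ℝ)} (hC : IsCopula C)
    (hmap : C.map (vecQuantile μ) = μ) (h : BoundedRD s C fun u => u) :
    BoundedRD s μ fun x => x := by
  have := hC.1
  have hmp : MeasurePreserving (vecQuantile μ) C μ := ⟨measurable_vecQuantile μ, hmap⟩
  rw [← boundedRD_iff_of_measurePreserving (X := fun x : Fin d → ℝ => x) hmp measurable_id]
  intro i g M hg hgm hM
  obtain ⟨g', hg', hgm', hM', heq⟩ := exists_monotone_extension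
    (q := fun k : {j : Fin d // j ≠ i} => quantile (marg μ k))
    (fun k => quantile_monotoneOn _) (fun k => measurable_quantile _) hg hgm hM
  have hcong : (fun u : Fin d → ℝ => s * g' (omitCoord (fun u => u) i u)) =ᵐ[C]
      fun u => s * g (omitCoord (fun u => vecQuantile μ u) i u) := by
    filter_upwards [hC.ae_mem_Ioo] with u hu
    exact congrArg (s * ·) (heq (omitCoord (fun u => u) i u) fun k => hu k)
  have hgX : Measurable fun u : Fin d → ℝ => g (omitCoord (fun u => vecQuantile μ u) i u) :=
    hg.comp (measurable_omitCoord (measurable_vecQuantile μ) i)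
  -- The copula lives on the open cube, so `g'` may be replaced by `g` of the quantiles; then the
  -- conditioning coordinate is coarsened to its quantile.
  exact ((h i g' M hg' hgm' hM').congr hcong).comp_quantile
    ((integrable_of_abs_le hgX fun u => hM _).const_mul s) (measurable_pi_apply i) (hC.2 i)
    (marg μ i)

/-- Regression dependence passes from `μ` to its checkerboard copula. -/
lemma BoundedRD.lawCheckerboard (h : BoundedRD s μ fun x => x) :
    BoundedRD s (lawCheckerboard μ) fun u => u := by
  rw [← boundedRD_iff_of_measurePreserving (X := fun x : Fin d → ℝ => x)
    (measurePreserving_vecTransform μ) measurable_id]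
  intro i g M hg hgm hM
  have hmT := measurable_vecTransform μ
  have hmQ := measurable_quantile (marg μ i)
  have hU : Measurable fun p : (Fin d → ℝ) × (Fin d → ℝ) => vecTransform μ p.1 p.2 i :=
    (measurable_pi_apply i).comp hmT
  let τ : ({j : Fin d // j ≠ i} → ℝ) → (Fin d → ℝ) → {j : Fin d // j ≠ i} → ℝ :=
    fun z v k => distTransform (marg μ k) (z k) (v k)
  have hτ : Measurable fun p : ({j : Fin d // j ≠ i} → ℝ) × (Fin d → ℝ) => τ p.1 p.2 := by
    refine measurable_pi_lambda _ fun k => ?_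
    exact (measurable_distTransform (marg μ k)).comp
      (g := fun p : ℝ × ℝ => distTransform (marg μ k) p.1 p.2)
      (f := fun p : ({j : Fin d // j ≠ i} → ℝ) × (Fin d → ℝ) => (p.1 k, p.2 k)) (by fun_prop)
  have hτz : ∀ z, Measurable (τ z) := fun z => hτ.comp measurable_prodMk_left
  have hgτ : ∀ z, Integrable (fun v => g (τ z v)) (cube d) := fun z =>
    integrable_of_abs_le (hg.comp (hτz z)) fun v => hM _
  -- The hypothesis on `μ` is applied to this average of `g` over the randomisation, which is again
  -- increasing and bounded by `M`.
  let G : ({j : Fin d // j ≠ i} → ℝ) → ℝ := fun z => ∫ v, g (τ z v) ∂cube d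
  have hGmeas : Measurable G :=
    (StronglyMeasurable.integral_prod_right (f := fun z v => g (τ z v))
      (hg.comp hτ).stronglyMeasurable).measurable
  have hGmono : Monotone G := by
    intro z w hzw
    refine integral_mono_ae (hgτ z) (hgτ w) ?_
    filter_upwards [ae_cube_mem_Icc] with v hv
    exact hgm fun k => distTransform_mono_left (marg μ k) (hv k) (hzw k)
  have hGM : ∀ z, |G z| ≤ M := fun z => by
    simpa using norm_integral_le_of_norm_le_const (μ := cube d) (C := M)
      (f := fun v => g (τ z v)) (Filter.Eventually.of_forall fun v => hM _)
  have hGX : Measurable fun x : Fin d → ℝ => G (omitCoord (fun x => x) i x) :=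
    hGmeas.comp (measurable_omitCoord measurable_id i)
  obtain ⟨h₀, T, hh, hT, hmono, hae, hint, htest⟩ := (condExpIncreasing_iff
    (Y := fun x : Fin d → ℝ => s * G (omitCoord (fun x => x) i x)) (Z := fun x : Fin d → ℝ => x i)
    ((integrable_of_abs_le hGX fun x => hGM _).const_mul s) (measurable_pi_apply i)).1
    (h i G M hGmeas hGmono hGM)
  have hgU : Measurable fun p : (Fin d → ℝ) × (Fin d → ℝ) =>
      g (omitCoord (fun p : (Fin d → ℝ) × (Fin d → ℝ) => vecTransform μ p.1 p.2) i p) :=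
    hg.comp (measurable_omitCoord hmT i)
  have hfst : MeasurePreserving Prod.fst (μ.prod (cube d)) μ := measurePreserving_fst
  have hQU : ∀ᵐ p ∂μ.prod (cube d), quantile (marg μ i) (vecTransform μ p.1 p.2 i) = p.1 i := by
    filter_upwards [ae_vecQuantile_vecTransform μ] with p hp
    exact congrFun hp i
  have hint' : Integrable (fun p : (Fin d → ℝ) × (Fin d → ℝ) => h₀ (p.1 i)) (μ.prod (cube d)) :=
    (hfst.integrable_comp hint.aestronglyMeasurable).2 hint
  refine (condExpIncreasing_iff
    (Z := fun p : (Fin d → ℝ) × (Fin d → ℝ) => vecTransform μ p.1 p.2 i)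
    ((integrable_of_abs_le hgU fun p => hM _).const_mul s) hU).2
    -- Since `X_i = Q_i(U_i)` almost surely, `h₀(X_i)` is a function of `U_i`. Intersecting with
    -- `(0,1)` secures monotonicity of the quantile.
    ⟨fun u => h₀ (quantile (marg μ i) u), Ioo 0 1 ∩ quantile (marg μ i) ⁻¹' T, hh.comp hmQ,
      measurableSet_Ioo.inter (hmQ hT), ?_, ?_, ?_, ?_⟩
  · exact fun u hu w hw huw => hmono hu.2 hw.2 (quantile_monotoneOn _ hu.1 hw.1 huw)
  · filter_upwards [ae_vecTransform_mem_Ioo μ, hQU, hfst.quasiMeasurePreserving.ae hae]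
      with p h1 h2 h3
    refine ⟨h1 i, ?_⟩
    rw [mem_preimage, h2]
    exact h3
  · refine hint'.congr ?_
    filter_upwards [hQU] with p hp
    rw [hp]
  · intro b hb hb1
    -- Averaging the test function over `V_i` turns it into a bounded test function of `X_i`.
    let β : ℝ → ℝ := fun t => ∫ v, b (distTransform (marg μ i) t (v i)) ∂cube d
    have hdt : Measurable fun p : ℝ × (Fin d → ℝ) => distTransform (marg μ i) p.1 (p.2 i) :=
      (measurable_distTransform (marg μ i)).comp
        (g := fun p : ℝ × ℝ => distTransform (marg μ i) p.1 p.2)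
        (f := fun p : ℝ × (Fin d → ℝ) => (p.1, p.2 i)) (by fun_prop)
    have hβ : Measurable β :=
      (StronglyMeasurable.integral_prod_right
        (f := fun t (v : Fin d → ℝ) => b (distTransform (marg μ i) t (v i)))
        (hb.comp hdt).stronglyMeasurable).measurable
    have hβ1 : ∀ t, |β t| ≤ 1 := fun t => by
      simpa using norm_integral_le_of_norm_le_const (μ := cube d) (C := 1)
        (f := fun v => b (distTransform (marg μ i) t (v i)))
        (Filter.Eventually.of_forall fun v => hb1 _)
    have hbU : Measurable fun p : (Fin d → ℝ) × (Fin d → ℝ) => b (vecTransform μ p.1 p.2 i) :=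
      hb.comp hU
    have hi1 : Integrable (fun p : (Fin d → ℝ) × (Fin d → ℝ) => b (vecTransform μ p.1 p.2 i) *
        (s * g (omitCoord (fun p : (Fin d → ℝ) × (Fin d → ℝ) => vecTransform μ p.1 p.2) i p)))
        (μ.prod (cube d)) :=
      ((integrable_of_abs_le hgU fun p => hM _).const_mul s).bdd_mul hbU.aestronglyMeasurable
        (Filter.Eventually.of_forall fun p => hb1 _)
    have hi2 : Integrable (fun p : (Fin d → ℝ) × (Fin d → ℝ) => b (vecTransform μ p.1 p.2 i) *
        h₀ (p.1 i)) (μ.prod (cube d)) :=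
      hint'.bdd_mul hbU.aestronglyMeasurable (Filter.Eventually.of_forall fun p => hb1 _)
    calc ∫ p, b (vecTransform μ p.1 p.2 i) * (s * g (omitCoord
            (fun p : (Fin d → ℝ) × (Fin d → ℝ) => vecTransform μ p.1 p.2) i p)) ∂(μ.prod (cube d))
        = ∫ x, β (x i) * (s * G (omitCoord (fun x => x) i x)) ∂μ := by
          rw [integral_prod _ hi1]
          refine integral_congr_ae (Filter.Eventually.of_forall fun x => ?_)
          -- For fixed `x` the first factor involves only `v i` and the second only the other
          -- coordinates of `v`, so they integrate separately.
          have hfac := integral_cube_mul (A := {i}) (B := {i}ᶜ) disjoint_compl_right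
            (f := fun v => b (vecTransform μ x v i))
            (g := fun v => s * g (τ (omitCoord (fun x => x) i x) v))
            (hbU.comp measurable_prodMk_left) ((hg.comp (hτz _)).const_mul s) ?_ ?_
          · refine hfac.trans ?_
            rw [integral_const_mul]
            rfl
          · intro v w hvw
            simp only [vecTransform, hvw i (by simp)]
          · intro v w hvw
            have : τ (omitCoord (fun x => x) i x) v = τ (omitCoord (fun x => x) i x) w :=
              funext fun k => by simp only [τ, hvw k (by simpa using k.2)]
            simp only [this]
      _ = ∫ x, β (x i) * h₀ (x i) ∂μ := htest β hβ hβ1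
      _ = ∫ p, b (vecTransform μ p.1 p.2 i) * h₀ (p.1 i) ∂(μ.prod (cube d)) := by
          rw [integral_prod _ hi2]
          refine integral_congr_ae (Filter.Eventually.of_forall fun x => ?_)
          exact (integral_mul_const _ _).symm
      _ = ∫ p, b (vecTransform μ p.1 p.2 i) *
            h₀ (quantile (marg μ i) (vecTransform μ p.1 p.2 i)) ∂(μ.prod (cube d)) :=
          integral_congr_ae (by
            filter_upwards [hQU] with p hp
            rw [hp])

lemma boundedRD_iff_map (hX : Measurable X) :
    BoundedRD s P X ↔ BoundedRD s (P.map X) fun x => x := by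
  have := Measure.isProbabilityMeasure_map (μ := P) hX.aemeasurable
  exact boundedRD_iff_of_measurePreserving (X := fun x : Fin d → ℝ => x)
    (⟨hX, rfl⟩ : MeasurePreserving X P (P.map X)) measurable_id

end Regression

/-! ### Transfer between a law and its copulas -/

section Transfer

variable {Ω : Type*} [MeasurableSpace Ω] {P : Measure Ω} [IsProbabilityMeasure P] {d : ℕ}
  {X : Ω → Fin d → ℝ}

/-- The dependence concepts only depend on the law. -/
lemma satisfies_iff_distSatisfies_map (hX : Measurable X) (D : Concept) :
    Satisfies P X D ↔ DistSatisfies (P.map X) D := by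
  have := Measure.isProbabilityMeasure_map (μ := P) hX.aemeasurable
  have hid : Measurable fun x : Fin d → ℝ => x := measurable_id
  have hmap : (P.map X).map (fun x : Fin d → ℝ => x) = P.map X := Measure.map_id
  cases D <;> simp only [DistSatisfies, Satisfies]
  · rw [isPA_iff hX, isPA_iff hid, hmap]
  · rw [isPRD_iff hX, isPRD_iff hid, boundedRD_iff_map hX]
  · rw [isWPA_iff hX, isWPA_iff hid, hmap]
  · rw [isPOD_iff hX, isPOD_iff hid, hmap]
  · rw [isNA_iff hX, isNA_iff hid, hmap]
  · rw [isNRD_iff hX, isNRD_iff hid, boundedRD_iff_map hX]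
  · rw [isWNA_iff hX, isWNA_iff hid, hmap]
  · rw [isNOD_iff hX, isNOD_iff hid, hmap]

variable {μ : Measure (Fin d → ℝ)} [IsProbabilityMeasure μ]

lemma distSatisfies_of_copula {C : Measure (Fin d → ℝ)} (hC : IsCopula C)
    (hmap : C.map (vecQuantile μ) = μ) {D : Concept} (h : DistSatisfies C D) :
    DistSatisfies μ D := by
  have := hC.1
  have hid : Measurable fun x : Fin d → ℝ => x := measurable_id
  have hmid : ∀ ν : Measure (Fin d → ℝ), ν.map (fun x => x) = ν := fun ν => Measure.map_id
  cases D <;> simp only [DistSatisfies, Satisfies] at h ⊢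
  · rw [isPA_iff hid, hmid] at h ⊢
    exact fun A B => (h A B).of_copula (Or.inl rfl) hC hmap
  · rw [isPRD_iff hid] at h ⊢
    exact h.of_copula hC hmap
  · rw [isWPA_iff hid, hmid] at h ⊢
    exact fun i => (h i).of_copula (Or.inr rfl) hC hmap
  · rw [isPOD_iff hid, hmid] at h ⊢
    exact ⟨h.1.of_copula (Or.inr rfl) hC hmap, h.2.of_copula (Or.inl rfl) hC hmap⟩
  · rw [isNA_iff hid, hmid] at h ⊢
    exact fun A B hAB => (h A B hAB).of_copula (Or.inl rfl) hC hmap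
  · rw [isNRD_iff hid] at h ⊢
    exact h.of_copula hC hmap
  · rw [isWNA_iff hid, hmid] at h ⊢
    exact fun i => (h i).of_copula (Or.inr rfl) hC hmap
  · rw [isNOD_iff hid, hmid] at h ⊢
    exact ⟨h.1.of_copula (Or.inr rfl) hC hmap, h.2.of_copula (Or.inl rfl) hC hmap⟩

lemma pairwise_disjoint_pair {A B : Finset (Fin d)} (hAB : Disjoint A B) :
    Pairwise fun j k : Fin 2 => Disjoint (![A, B] j) (![A, B] k) := by
  intro j k hjk
  fin_cases j <;> fin_cases k
  · exact absurd rfl hjk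
  · exact hAB
  · exact hAB.symm
  · exact absurd rfl hjk

lemma distSatisfies_lawCheckerboard {D : Concept} (h : DistSatisfies μ D) :
    DistSatisfies (lawCheckerboard μ) D := by
  have hid : Measurable fun x : Fin d → ℝ => x := measurable_id
  have hmid : ∀ ν : Measure (Fin d → ℝ), ν.map (fun x => x) = ν := fun ν => Measure.map_id
  have hup : ∀ S : Set (Fin d → ℝ), IsUpperSet S → ∀ φ : (Fin d → ℝ) → (Fin d → ℝ),
      Monotone φ → IsUpperSet (φ ⁻¹' S) := fun S hS φ hφ => hS.preimage hφ
  have hlow : ∀ S : Set (Fin d → ℝ), IsLowerSet S → ∀ φ : (Fin d → ℝ) → (Fin d → ℝ),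
      Monotone φ → IsLowerSet (φ ⁻¹' S) := fun S hS φ hφ => hS.preimage hφ
  have hsing : Pairwise fun j k : Fin d => Disjoint ({j} : Finset (Fin d)) {k} := fun j k hjk =>
    Finset.disjoint_singleton.2 hjk
  cases D <;> simp only [DistSatisfies, Satisfies] at h ⊢
  · rw [isPA_iff hid, hmid] at h ⊢
    exact fun A B => (h A B).lawCheckerboard_pair
  · rw [isPRD_iff hid] at h ⊢
    exact h.lawCheckerboard
  · rw [isWPA_iff hid, hmid] at h ⊢
    exact fun i => (h i).lawCheckerboard hlow (pairwise_disjoint_pair disjoint_compl_right)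
  · rw [isPOD_iff hid, hmid] at h ⊢
    exact ⟨h.1.lawCheckerboard hlow hsing, h.2.lawCheckerboard hup hsing⟩
  · rw [isNA_iff hid, hmid] at h ⊢
    exact fun A B hAB => (h A B hAB).lawCheckerboard hup (pairwise_disjoint_pair hAB)
  · rw [isNRD_iff hid] at h ⊢
    exact h.lawCheckerboard
  · rw [isWNA_iff hid, hmid] at h ⊢
    exact fun i => (h i).lawCheckerboard hlow (pairwise_disjoint_pair disjoint_compl_right)
  · rw [isNOD_iff hid, hmid] at h ⊢
    exact ⟨h.1.lawCheckerboard hlow hsing, h.2.lawCheckerboard hup hsing⟩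

end Transfer

end CopulaDependence

theorem theorem3 {Ω : Type*} [MeasurableSpace Ω] (P : Measure Ω) [IsProbabilityMeasure P]
    (d : ℕ) (hd : 2 ≤ d) (X : Ω → Fin d → ℝ) (hX : Measurable X)
    (D : CopulaDependence.Concept) :
    (CopulaDependence.Satisfies P X D ↔
      ∃ C : Measure (Fin d → ℝ),
        CopulaDependence.IsCopulaOf C P X ∧ CopulaDependence.DistSatisfies C D) ∧
    CopulaDependence.IsCopulaOf (CopulaDependence.checkerboard P X) P X ∧
    (CopulaDependence.Satisfies P X D →
      CopulaDependence.DistSatisfies (CopulaDependence.checkerboard P X) D) := by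
  have := Measure.isProbabilityMeasure_map (μ := P) hX.aemeasurable
  have hcop : CopulaDependence.IsCopulaOf (CopulaDependence.checkerboard P X) P X := by
    rw [CopulaDependence.isCopulaOf_iff hX, CopulaDependence.checkerboard_eq_lawCheckerboard hX]
    exact ⟨CopulaDependence.isCopula_lawCheckerboard _,
      CopulaDependence.real_Iic_eq_lawCheckerboard _⟩
  have hsat : CopulaDependence.Satisfies P X D →
      CopulaDependence.DistSatisfies (CopulaDependence.checkerboard P X) D := by
    rw [CopulaDependence.satisfies_iff_distSatisfies_map hX,
      CopulaDependence.checkerboard_eq_lawCheckerboard hX]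
    exact CopulaDependence.distSatisfies_lawCheckerboard
  refine ⟨⟨fun h => ⟨_, hcop, hsat h⟩, ?_⟩, hcop, hsat⟩
  rintro ⟨C, hC, hCD⟩
  rw [CopulaDependence.isCopulaOf_iff hX] at hC
  rw [CopulaDependence.satisfies_iff_distSatisfies_map hX]
  exact CopulaDependence.distSatisfies_of_copula hC.1
    (CopulaDependence.map_vecQuantile hC.1 hC.2) hCD
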